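/- Fix an integer $k\ge 0$. Let $\mathcal L$ be the family of all lines of slope $0$, $-1$ and $\infty$ in $\mathbb R^2$ through integral points, each line cut at the integral points into segments. For $(p,q)\in\mathbb Z^2$ let $\gamma^L_{(p,q)}$ be the straight segment directed from $(0,0)$ to $(p,q)$, pushed slightly to its left near each interior point of it of the form $(n/2,m/2)$ with $n,m\in\mathbb Z$. Let $\tau_1,\dots,\tau_r$ be the segments of $\mathcal L$ crossed by $\gamma^L_{(p,q)}$, in order, and let $\mathcal P_{(p,q)}$ be the poset on the elements $(\tau_j,i)$ with $1\le j\le r$, $0\le i\le k$, whose order is generated by the following relations. - If the crossing point with $\tau_j$ is strictly closer to the endpoint of $\tau_j$ on the right of the curve than to the one on its left, then $(\tau_j,0)\succ(\tau_j,1)\succ\cdots\succ(\tau_j,k)$; otherwise $(\tau_j,0)\prec(\tau_j,1)\prec\cdots\prec(\tau_j,k)$. - If the common endpoint of $\tau_j$ and $\tau_{j+1}$ lies to the right of the curve, then $(\tau_j,k)\succ(\tau_{j+1},0)$; if it lies to the left, then $(\tau_j,k)\prec(\tau_{j+1},0)$. Let $m^{(k)}_{(p,q)}$ be the number of order ideals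 (downward closed subsets, including the empty one) of $\mathcal P_{(p,q)}$. Put $$\alpha=4k^2+12k+5,\qquad \beta=3k^2+8k+6,\qquad \delta=3k^4+17k^3+34k^2+28k+8,$$ $$A=\frac{2k^2+3k+1+(1+k)\sqrt\alpha}{2(1+2k)\sqrt\alpha},\qquad B=\frac{(k+1)(k+2)(\beta^2-4)+\delta\sqrt{\beta^2-4}}{(\beta-2)(\beta^2-4)}.$$ **Lemma.** For any two coprime positive integers $a_1,a_2$, the limits $$S(a_1,a_2)_-:=\lim_{q\to\infty}\frac{m^{(k)}_{(q(1+a_1)+a_2,\;1)}}{m^{(k)}_{(q(1+a_1),\;1+a_1)}},\qquad S(a_1,a_2)_+:=\lim_{q\to\infty}\frac{m^{(k)}_{((q+1)(1+a_1+a_2),\;q(1+a_1+a_2))}}{m^{(k)}_{(q(1+a_1+a_2)+a_1+1,\;q(1+a_1+a_2)+a_1)}}$$ (over positive integers $q$) exist, and $$S(a_1,a_2)_-=\bigl((3+3k)A\bigr)^{-a_1}\left(\frac{3+2k+\sqrt\alpha}{2}\right)^{a_2},\qquad S(a_1,a_2)_+=\bigl((3+3k)B\bigr)^{a_1+a_2}\left(\frac{\beta+\sqrt{\beta^2-4}}{2}\right)^{-a_1}.$$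 -/

import Mathlib

open Filter Topology

/-- The planar determinant of two integer vectors. For a direction `v` and a lattice point `P`,
`0 < planeDet v P` says that `P` lies strictly to the left of the line through the origin directed by
`v`, and `|planeDet v P|` is proportional to the distance of `P` from this line. -/
def planeDet (v w : ℤ × ℤ) : ℤ := v.1 * w.2 - v.2 * w.1

/-- The planar dot product of two integer vectors. -/
def planeDot (v w : ℤ × ℤ) : ℤ := v.1 * w.1 + v.2 * w.2

/-- `P` and `Q` are the two endpoints of one of the segments (between consecutive
integral points) of the lattice `𝓛` of all lines
of slope `0`, `∞` and `-1` through integral points. -/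
def IsLatticeSegment (P Q : ℤ × ℤ) : Prop :=
  Q - P = (1, 0) ∨ Q - P = (-1, 0) ∨ Q - P = (0, 1) ∨ Q - P = (0, -1) ∨
    Q - P = (1, -1) ∨ Q - P = (-1, 1)

/-- The parameter `t` at which the line `t ↦ t • v` meets the line through `L` and `R`
(Cramer's rule for `t • v = L + s • (R - L)`). -/
def hitTime (v L R : ℤ × ℤ) : ℚ := (planeDet R L : ℚ) / (planeDet v (L - R) : ℚ)

/-- The velocity, in `ε`, of the parameter at which the line is met by the segment when the line
`t ↦ t • v` is pushed to its left to `t ↦ t • v + ε • (-v.2, v.1)`: the parameter becomes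
`hitTime v L R + ε * hitDrift v L R`. -/
def hitDrift (v L R : ℤ × ℤ) : ℚ := (planeDot v (L - R) : ℚ) / (planeDet v (L - R) : ℚ)

/-- A crossing of the curve `γ^L_v` with a segment of `𝓛`. Here `γ^L_v` is the straight segment
from the origin to `v` (directed from the origin to `v`), pushed slightly to its left at
every interior point of it that has half-integral coordinates.
A lattice point in the interior of the straight segment is passed on its left, so it counts as
lying to the right of the curve, and so a segment of `𝓛` is crossed exactly if one endpoint
`left` is strictly to the left of the line, the other endpoint `right` is on the line or to the
right of it, and the straight segment meets it at a point other than its two ends `0` and `v`.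
(The segments with `planeDet v right = 0` are those crossed on the detour around `right`.) -/
@[ext] structure Crossing (v : ℤ × ℤ) where
  /-- the endpoint of the crossed segment to the left of the curve -/
  left : ℤ × ℤ
  /-- the endpoint of the crossed segment to the right of the curve -/
  right : ℤ × ℤ
  isSegment : IsLatticeSegment left right
  left_pos : 0 < planeDet v left
  right_nonpos : planeDet v right ≤ 0
  time_pos : 0 < hitTime v left right
  time_lt_one : hitTime v left right < 1

namespace Crossing

variable {v : ℤ × ℤ}

/-- The position of a crossing along `γ^L_v`: crossings come in the order of the parameter of the
line, and the crossings met on the detour around one lattice point, which share this parameter,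
come in the order in which a slight left translate of the line meets them. -/
def position (c : Crossing v) : ℚ ×ₗ ℚ :=
  toLex (hitTime v c.left c.right, hitDrift v c.left c.right)

/-- The curve crosses the segments of `c` and `c'` consecutively, in this order. -/
def Consecutive (c c' : Crossing v) : Prop :=
  c.position < c'.position ∧ ∀ d : Crossing v, ¬ (c.position < d.position ∧
    d.position < c'.position)

/-- The crossing point is strictly closer to the right endpoint of the segment than to the left
one. A straight line through the midpoint is pushed to the left there, so
that this case does not count. -/
def CloserToRight (c : Crossing v) : Prop := |planeDet v c.right| < |planeDet v c.left|

end Crossing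

/-- The generating relations `x ≺ y` of the fence poset `𝒫_v`. Its elements are the pairs `(τ, i)`
with `τ` a crossing of `γ^L_v` and `0 ≤ i ≤ k`. -/
inductive FenceRel (k : ℕ) (v : ℤ × ℤ) :
    Crossing v × Fin (k + 1) → Crossing v × Fin (k + 1) → Prop
  /-- If the crossing is closer to the right endpoint, then `(τ,0) ≻ (τ,1) ≻ ⋯ ≻ (τ,k)`. -/
  | chainDown (c : Crossing v) (i : Fin k) (h : c.CloserToRight) :
      FenceRel k v (c, i.succ) (c, i.castSucc)
  /-- Otherwise `(τ,0) ≺ (τ,1) ≺ ⋯ ≺ (τ,k)`. -/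
  | chainUp (c : Crossing v) (i : Fin k) (h : ¬ c.CloserToRight) :
      FenceRel k v (c, i.castSucc) (c, i.succ)
  /-- If the common endpoint of consecutive `τ`, `τ'` is on the right, then `(τ,k) ≻ (τ',0)`. -/
  | linkDown (c c' : Crossing v) (h : c.Consecutive c') (hr : c.right = c'.right) :
      FenceRel k v (c', 0) (c, Fin.last k)
  /-- If the common endpoint of consecutive `τ`, `τ'` is on the left, then `(τ,k) ≺ (τ',0)`. -/
  | linkUp (c c' : Crossing v) (h : c.Consecutive c') (hl : c.left = c'.left) :
      FenceRel k v (c, Fin.last k) (c', 0)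

/-- The order of the fence poset `𝒫_v`: the reflexive transitive closure of its generating
relations. -/
def FenceLE (k : ℕ) (v : ℤ × ℤ) (x y : Crossing v × Fin (k + 1)) : Prop :=
  Relation.ReflTransGen (FenceRel k v) x y

/-- The order ideals (downwards closed subsets, the empty one included) of `𝒫_v`. -/
def fenceIdeals (k : ℕ) (v : ℤ × ℤ) : Set (Set (Crossing v × Fin (k + 1))) :=
  {I | ∀ x ∈ I, ∀ y, FenceLE k v y x → y ∈ I}

/-- The generalized `k`-Markov number `m^{(k)}_{(p,q)}`: the number of order ideals of the fence
poset `𝒫_{(p,q)}`. -/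
noncomputable def genMarkov (k : ℕ) (p q : ℤ) : ℕ := (fenceIdeals k (p, q)).ncard

/-! ### Counting order ideals of linear fences by transfer matrices -/

/-! The fence poset is a zigzag on a line, so its order ideals are 0/1-colourings with one
constraint per step, and a transfer matrix counts them: `genMarkov` is the sum of the entries of a
product of the unipotent matrices `stepMatrix true` and `stepMatrix false` (`lowerSets_ncard`). On
the antidiagonal `x + y = s` everything is governed by the remainder `ρ` of `q * s` modulo `p + q`:
it decides which segment is crossed next, on which side the shared endpoint lies, and which endpoint
is closer. This yields `fenceMatrix` (`genMarkov_eq`).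

Scaling the vector does not change the cells, and the cells repeat with period `a + b`. Hence, for
`F` the matrix of `(a, b)` and `D` the detour matrix, the matrix of `(d + 1) • (a, b)` is `(F * D) ^
d * F`. Here `D = (3k+3) J + W`, with `J` the all-ones matrix and `W` antisymmetric, so if `F 0 1 -
F 1 0 = -k` the trace of `F * D` is `(3+3k) m - k`, with `m` the entry sum of `F`. Cayley–Hamilton
turns the powers into the recursion `chebValue` (`genMarkov_multiple`), whose `d`-th value grows
like `(3+3k)^d m^(d+1)`.

For `(n, 1)` and `(n + 1, n)`, raising `n` by two replaces `F` by `P * F * Pᵀ` with a fixed `P` of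
determinant one. This preserves `F 0 1 - F 1 0`, and makes the entry sums satisfy a linear recursion
with characteristic roots the eigenvalues of `P`. Consequently they are asymptotic to `A l^n` and `B
l^n`, with `l` the larger eigenvalue. In both quotients the powers `l^q` cancel, and only the stated
constants remain. -/

/-- Ordered product `f 0 * f 1 * ⋯ * f (n - 1)`. -/
def seqProd {M : Type*} [Monoid M] (f : ℕ → M) : ℕ → M
  | 0 => 1
  | n + 1 => seqProd f n * f n

section seqProd

variable {M : Type*} [Monoid M]

@[simp] lemma seqProd_zero (f : ℕ → M) : seqProd f 0 = 1 := rfl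

lemma seqProd_succ (f : ℕ → M) (n : ℕ) : seqProd f (n + 1) = seqProd f n * f n := rfl

lemma seqProd_congr {f g : ℕ → M} {n : ℕ} (h : ∀ i < n, f i = g i) :
    seqProd f n = seqProd g n := by
  induction n with
  | zero => rfl
  | succ n ih =>
    rw [seqProd_succ, seqProd_succ, ih fun i hi => h i (by omega), h n (by omega)]

lemma seqProd_const (a : M) (n : ℕ) : seqProd (fun _ => a) n = a ^ n := by
  induction n with
  | zero => simp
  | succ n ih => rw [seqProd_succ, ih, pow_succ]

lemma seqProd_add (f : ℕ → M) (m n : ℕ) :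
    seqProd f (m + n) = seqProd f m * seqProd (fun i => f (m + i)) n := by
  induction n with
  | zero => simp
  | succ n ih => rw [← add_assoc, seqProd_succ, ih, seqProd_succ, mul_assoc]

lemma seqProd_succ' (f : ℕ → M) (n : ℕ) :
    seqProd f (n + 1) = f 0 * seqProd (fun i => f (i + 1)) n := by
  rw [add_comm, seqProd_add]
  simp [seqProd_succ, add_comm]

lemma seqProd_mul (f : ℕ → M) (m n : ℕ) :
    seqProd f (m * n) = seqProd (fun i => seqProd (fun j => f (m * i + j)) m) n := by
  induction n with
  | zero => simp
  | succ n ih => rw [Nat.mul_succ, seqProd_add, ih, seqProd_succ]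

end seqProd

/-- The sum over all paths of the product of the weights of their steps. -/
lemma sum_paths (f : ℕ → Matrix (Fin 2) (Fin 2) ℝ) (N : ℕ) (g : Fin 2 → ℝ) :
    ∑ χ : Fin (N + 1) → Fin 2,
        (∏ t : Fin N, f t (χ t.castSucc) (χ t.succ)) * g (χ (Fin.last N)) =
      ∑ a, ∑ b, seqProd f N a b * g b := by
  induction N generalizing g with
  | zero =>
    rw [← (Equiv.funUnique (Fin 1) (Fin 2)).symm.sum_comp]
    simp [Matrix.one_apply]
  | succ N ih =>
    rw [← (Fin.snocEquiv fun _ => Fin 2).sum_comp, Fintype.sum_prod_type, Finset.sum_comm]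
    -- The last step is absorbed into the terminal weight, which is why `g` is kept general in the
    -- induction.
    have key := ih fun a => ∑ b, f N a b * g b
    have h1 : ∀ (χ : Fin (N + 1) → Fin 2),
        ∑ b, (∏ t : Fin (N + 1), f t ((Fin.snocEquiv fun _ => Fin 2) (b, χ) t.castSucc)
          ((Fin.snocEquiv fun _ => Fin 2) (b, χ) t.succ)) *
            g ((Fin.snocEquiv fun _ => Fin 2) (b, χ) (Fin.last (N + 1))) =
        (∏ t : Fin N, f t (χ t.castSucc) (χ t.succ)) *
          ∑ b, f N (χ (Fin.last N)) b * g b := by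
      intro χ
      rw [Finset.mul_sum]
      refine Finset.sum_congr rfl fun b _ => ?_
      rw [Fin.prod_univ_castSucc]
      have h2 : ∀ t : Fin N, (Fin.snocEquiv fun _ => Fin 2) (b, χ) t.castSucc.succ = χ t.succ := by
        intro t
        rw [Fin.succ_castSucc]
        simp only [Fin.snocEquiv_apply, Fin.snoc_castSucc]
      simp only [h2]
      simp only [Fin.snocEquiv_apply, Fin.snoc_castSucc, Fin.succ_last, Fin.snoc_last,
        Fin.val_castSucc, Fin.val_last]
      ring
    rw [Finset.sum_congr rfl fun χ _ => h1 χ, key]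
    refine Finset.sum_congr rfl fun a _ => ?_
    simp only [seqProd_succ, Matrix.mul_apply, Finset.mul_sum, Finset.sum_mul]
    rw [Finset.sum_comm]
    refine Finset.sum_congr rfl fun b _ => Finset.sum_congr rfl fun c _ => by ring

/-- The transfer matrix of one covering relation: its entry `(a, b)` tells if two consecutive
elements of the fence may have membership `a` and `b` in an ideal. The Boolean is `true` if the
fence goes down. -/
def stepMatrix (down : Bool) : Matrix (Fin 2) (Fin 2) ℝ :=
  if down then !![1, 1; 0, 1] else !![1, 0; 1, 1]

lemma stepMatrix_apply (d : Bool) (a b : Fin 2) :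
    stepMatrix d a b =
      if (if d then (a = 1 → b = 1) else (b = 1 → a = 1)) then 1 else 0 := by
  cases d <;> fin_cases a <;> fin_cases b <;> simp [stepMatrix]

/-- The sum of the entries of a `2 × 2` matrix. -/
def entrySum (M : Matrix (Fin 2) (Fin 2) ℝ) : ℝ := M 0 0 + M 0 1 + M 1 0 + M 1 1

/-- Ideals correspond to membership colourings along the enumeration `e`. A colouring contributes
the product of the 0/1 entries of its step matrices, which is 1 exactly when every constraint holds,
so the sum over paths is the count. -/
lemma lowerSets_ncard {X : Type*} (R : X → X → Prop) (N : ℕ) (e : X → ℕ)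
    (einj : Function.Injective e) (elt : ∀ x, e x < N + 1) (esurj : ∀ t < N + 1, ∃ x, e x = t)
    (σ : ℕ → Bool)
    (hR : ∀ x y, R x y ↔ (e x = e y + 1 ∧ σ (e y) = true) ∨ (e y = e x + 1 ∧ σ (e x) = false)) :
    (({I | ∀ x ∈ I, ∀ y, Relation.ReflTransGen R y x → y ∈ I} : Set (Set X)).ncard : ℝ) =
      entrySum (seqProd (fun t => stepMatrix (σ t)) N) := by
  classical
  let E : X ≃ Fin (N + 1) := Equiv.ofBijective (fun x => ⟨e x, elt x⟩)
    ⟨fun x y h => einj (by simpa using h), fun t => by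
      obtain ⟨x, hx⟩ := esurj t t.2
      exact ⟨x, Fin.ext hx⟩⟩
  have hE : ∀ x, ((E x : Fin (N + 1)) : ℕ) = e x := fun x => rfl
  let V : (Fin (N + 1) → Fin 2) → Prop := fun χ => ∀ t : Fin N,
    if σ t then (χ t.castSucc = 1 → χ t.succ = 1) else (χ t.succ = 1 → χ t.castSucc = 1)
  have h1 := sum_paths (fun t => stepMatrix (σ t)) N (fun _ => 1)
  have h2 : ∀ χ : Fin (N + 1) → Fin 2,
      (∏ t : Fin N, stepMatrix (σ t) (χ t.castSucc) (χ t.succ)) * 1 = if V χ then 1 else 0 := by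
    intro χ
    simp only [stepMatrix_apply, mul_one]
    rw [Finset.prod_ite_zero]
    simp [V]
  rw [Finset.sum_congr rfl fun χ _ => h2 χ, Finset.sum_boole] at h1
  have h3 : ∑ a, ∑ b, seqProd (fun t => stepMatrix (σ t)) N a b * 1 =
      entrySum (seqProd (fun t => stepMatrix (σ t)) N) := by
    simp only [Fin.sum_univ_two, mul_one, entrySum]; ring
  rw [← h3, ← h1, ← Set.ncard_coe_finset]
  congr 1
  -- Closure under the generating relation already gives closure under its reflexive transitive
  -- closure, so only neighbours in the enumeration matter.
  have closed_iff : ∀ I : Set X, (∀ x ∈ I, ∀ y, Relation.ReflTransGen R y x → y ∈ I) ↔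
      ∀ x y, R y x → x ∈ I → y ∈ I := by
    intro I
    refine ⟨fun h x y hxy hx => h x hx y (.single hxy), fun h x hx y hyx => ?_⟩
    induction hyx using Relation.ReflTransGen.head_induction_on with
    | refl => exact hx
    | head hab _ ih => exact h _ _ hab ih
  refine (Set.ncard_congr (fun (χ : Fin (N + 1) → Fin 2) _ => {x : X | χ (E x) = 1})
    ?_ ?_ ?_).symm
  · intro χ hχ
    simp only [Finset.coe_filter, Finset.mem_univ, true_and, Set.mem_ofPred_eq] at hχ
    rw [Set.mem_ofPred_eq, closed_iff]
    intro x y hyx hx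
    simp only [Set.mem_ofPred_eq] at hx ⊢
    rcases (hR y x).1 hyx with ⟨h, hs⟩ | ⟨h, hs⟩
    · have hlt : e x < N := by have := elt y; omega
      have := hχ ⟨e x, hlt⟩
      simp only [hs, if_true] at this
      have e1 : E x = (⟨e x, hlt⟩ : Fin N).castSucc := Fin.ext rfl
      have e2 : E y = (⟨e x, hlt⟩ : Fin N).succ := Fin.ext h
      rw [e2]; exact this (by rw [← e1]; exact hx)
    · have hlt : e y < N := by have := elt x; omega
      have := hχ ⟨e y, hlt⟩
      simp only [hs, Bool.false_eq_true, if_false] at this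
      have e1 : E y = (⟨e y, hlt⟩ : Fin N).castSucc := Fin.ext rfl
      have e2 : E x = (⟨e y, hlt⟩ : Fin N).succ := Fin.ext h
      rw [e1]; exact this (by rw [← e2]; exact hx)
  · intro χ χ' _ _ h
    funext t
    have := Set.ext_iff.1 h (E.symm t)
    simp only [Set.mem_ofPred_eq, Equiv.apply_symm_apply] at this
    generalize χ t = a at this ⊢
    generalize χ' t = b at this ⊢
    fin_cases a <;> fin_cases b <;> simp_all
  · intro I hI
    rw [Set.mem_ofPred_eq, closed_iff] at hI
    refine ⟨fun t => if E.symm t ∈ I then 1 else 0, ?_, ?_⟩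
    · simp only [Finset.coe_filter, Finset.mem_univ, true_and, Set.mem_ofPred_eq]
      intro t
      have e1 : e (E.symm t.castSucc) = t := by rw [← hE]; simp
      have e2 : e (E.symm t.succ) = t + 1 := by rw [← hE]; simp
      cases hs : σ t
      · have := hI (E.symm t.succ) (E.symm t.castSucc) ((hR _ _).2 (Or.inr ⟨by omega, by
          rw [e1]; exact hs⟩))
        simpa using this
      · have := hI (E.symm t.castSucc) (E.symm t.succ) ((hR _ _).2 (Or.inl ⟨by omega, by
          rw [e1]; exact hs⟩))
        simpa using this
    · ext x
      simp

/-! ### The crossings of the curve -/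

/-- The endpoint on the right of the curve of the `j`-th crossed segment. -/
def crossRight (p q j : ℕ) : ℤ × ℤ :=
  if j % 2 = 0 ∨ q * (j / 2 + 1) % (p + q) < p then
    ((j / 2 + 1 : ℕ) - (q * (j / 2 + 1) / (p + q) : ℕ), (q * (j / 2 + 1) / (p + q) : ℕ))
  else ((j / 2 + 1 : ℕ) - (q * (j / 2 + 1) / (p + q) : ℕ), (q * (j / 2 + 1) / (p + q) : ℕ) + 1)

/-- The endpoint on the left of the curve of the `j`-th crossed segment. -/
def crossLeft (p q j : ℕ) : ℤ × ℤ :=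
  if j % 2 = 1 ∧ q * (j / 2 + 1) % (p + q) < p then
    ((j / 2 + 1 : ℕ) - (q * (j / 2 + 1) / (p + q) : ℕ), (q * (j / 2 + 1) / (p + q) : ℕ) + 1)
  else ((j / 2 + 1 : ℕ) - (q * (j / 2 + 1) / (p + q) : ℕ) - 1,
    (q * (j / 2 + 1) / (p + q) : ℕ) + 1)

/-- Whether the chain of the `j`-th crossed segment goes down. -/
def chainDir (p q j : ℕ) : Bool :=
  if j % 2 = 0 then decide (2 * (q * (j / 2 + 1) % (p + q)) < p + q)
  else if q * (j / 2 + 1) % (p + q) < p then decide (2 * (q * (j / 2 + 1) % (p + q)) < p)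
  else decide (2 * (q * (j / 2 + 1) % (p + q)) < 2 * p + q)

/-- Whether the link from the `j`-th crossed segment to the next one goes down. -/
def linkDir (p q j : ℕ) : Bool :=
  if j % 2 = 0 then decide (q * (j / 2 + 1) % (p + q) < p)
  else decide (p ≤ q * (j / 2 + 1) % (p + q))

lemma two_mul_div_add_one (i : ℕ) : 2 * i / 2 + 1 = i + 1 := by omega

lemma two_mul_add_one_div_add_one (i : ℕ) : (2 * i + 1) / 2 + 1 = i + 1 := by omega

section

variable {p q : ℕ}

/-- The lattice point of the antidiagonal `x + y = s` next to the right of the line is determined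
by division with remainder. -/
lemma div_mod_of_det (hpq : 0 < p + q) {s : ℕ} {x y : ℤ} (hs : x + y = s)
    (h1 : (p : ℤ) * y - q * x ≤ 0) (h2 : 0 < (p : ℤ) * y - q * x + p + q) :
    ((q * s / (p + q) : ℕ) : ℤ) = y ∧ ((q * s % (p + q) : ℕ) : ℤ) = q * x - p * y := by
  have hpos : (0 : ℤ) < p + q := by exact_mod_cast hpq
  have := (Int.ediv_emod_unique (a := (q : ℤ) * s) (b := p + q) (r := q * x - p * y) (q := y)
    hpos).2 ⟨by rw [← hs]; ring, by linarith, by linarith⟩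
  push_cast
  exact this

lemma div_mod_spec (hpq : 0 < p + q) (s : ℕ) :
    ((p : ℤ) + q) * (q * s / (p + q) : ℕ) + (q * s % (p + q) : ℕ) = q * s ∧
      ((q * s % (p + q) : ℕ) : ℤ) < p + q := by
  constructor
  · exact_mod_cast Nat.div_add_mod (q * s) (p + q)
  · exact_mod_cast Nat.mod_lt _ hpq

/-- The values of `planeDet` at the two ends of a crossed segment differ by exactly `q`, `p` or `p +
q`, so the sign conditions pin down a quotient and remainder. The bounds on `hitTime` confine the
crossing to the stretch between the antidiagonals `0` and `p + q`. -/
lemma exists_index (hp : 0 < p) (hq : 0 < q) (c : Crossing ((p : ℤ), (q : ℤ))) :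
    ∃ j < 2 * (p + q) - 3, c.left = crossLeft p q j ∧ c.right = crossRight p q j := by
  obtain ⟨⟨l1, l2⟩, ⟨x, y⟩, hseg, hl, hr, ht0, ht1⟩ := c
  have hp' : (0 : ℤ) < p := by exact_mod_cast hp
  have hq' : (0 : ℤ) < q := by exact_mod_cast hq
  simp only [planeDet] at hl hr
  have hpq : 0 < p + q := by omega
  simp only [IsLatticeSegment, Prod.mk_sub_mk, Prod.mk.injEq] at hseg
  rcases hseg with ⟨h1, h2⟩ | ⟨h1, h2⟩ | ⟨h1, h2⟩ | ⟨h1, h2⟩ | ⟨h1, h2⟩ | ⟨h1, h2⟩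
  · obtain rfl : l1 = x - 1 := by omega
    obtain rfl : y = l2 := by omega
    have e1 : planeDet (x, y) (x - 1, y) = y := by simp [planeDet]; ring
    have e2 : planeDet ((p : ℤ), (q : ℤ)) ((x - 1, y) - (x, y)) = q := by simp [planeDet]
    simp only [hitTime, e1, e2] at ht0 ht1
    have hqQ : (0 : ℚ) < ((q : ℤ) : ℚ) := by exact_mod_cast hq
    have hy0 : 0 < y := by
      have := (div_pos_iff_of_pos_right hqQ).1 ht0
      exact_mod_cast this
    have hyq : y < q := by
      rw [div_lt_one hqQ] at ht1
      exact_mod_cast ht1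
    have hx0 : 0 < x := by
      by_contra hx
      nlinarith
    have hxp : x ≤ p := by
      by_contra hx
      nlinarith
    -- A horizontal crossing is indexed by the antidiagonal before its right endpoint; the nearest
    -- lattice point to the right on it is `(x, y - 1)`.
    obtain ⟨i, hi⟩ : ∃ i : ℕ, x + y - 2 = i := ⟨(x + y - 2).toNat, by omega⟩
    obtain ⟨d1, d2⟩ := div_mod_of_det (p := p) (q := q) hpq (s := i + 1) (x := x) (y := y - 1)
      (by push_cast; omega) (by linarith) (by linarith)
    have hge : ¬ q * (i + 1) % (p + q) < p := by
      rw [not_lt, ← Nat.cast_le (α := ℤ), d2]; linarith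
    refine ⟨2 * i + 1, by omega, ?_, ?_⟩
    · simp only [crossLeft, two_mul_add_one_div_add_one, hge, and_false, if_false, d1]
      ext <;> simp; omega
    · have : ¬ (2 * i + 1) % 2 = 0 := by omega
      simp only [crossRight, two_mul_add_one_div_add_one, hge, this, or_self, if_false, d1]
      ext <;> simp; omega
  -- The three reversed orientations would put `left` to the right of `right`.
  · obtain rfl : l1 = x + 1 := by omega
    obtain rfl : y = l2 := by omega
    linarith
  · obtain rfl : x = l1 := by omega
    obtain rfl : l2 = y - 1 := by omega
    linarith
  · obtain rfl : x = l1 := by omega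
    obtain rfl : l2 = y + 1 := by omega
    have e1 : planeDet (x, y) (x, y + 1) = x := by simp [planeDet]; ring
    have e2 : planeDet ((p : ℤ), (q : ℤ)) ((x, y + 1) - (x, y)) = p := by simp [planeDet]
    simp only [hitTime, e1, e2] at ht0 ht1
    have hpQ : (0 : ℚ) < ((p : ℤ) : ℚ) := by exact_mod_cast hp
    have hx0 : 0 < x := by
      have := (div_pos_iff_of_pos_right hpQ).1 ht0
      exact_mod_cast this
    have hxp : x < p := by
      rw [div_lt_one hpQ] at ht1
      exact_mod_cast ht1
    have hy0 : 0 ≤ y := by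
      by_contra hy
      nlinarith
    have hyq : y < q := by
      by_contra hy
      nlinarith
    obtain ⟨i, hi⟩ : ∃ i : ℕ, x + y - 1 = i := ⟨(x + y - 1).toNat, by omega⟩
    obtain ⟨d1, d2⟩ := div_mod_of_det (p := p) (q := q) hpq (s := i + 1) (x := x) (y := y)
      (by push_cast; omega) (by linarith) (by linarith)
    have hge : q * (i + 1) % (p + q) < p := by
      rw [← Nat.cast_lt (α := ℤ), d2]; linarith
    refine ⟨2 * i + 1, by omega, ?_, ?_⟩
    · have : (2 * i + 1) % 2 = 1 := by omega
      simp only [crossLeft, two_mul_add_one_div_add_one, hge, this, and_self, if_true, d1]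
      ext <;> simp; omega
    · simp only [crossRight, two_mul_add_one_div_add_one, hge, or_true, if_true, d1]
      ext <;> simp; omega
  · obtain rfl : l1 = x - 1 := by omega
    obtain rfl : l2 = y + 1 := by omega
    have e1 : planeDet (x, y) (x - 1, y + 1) = x + y := by simp [planeDet]; ring
    have e2 : planeDet ((p : ℤ), (q : ℤ)) ((x - 1, y + 1) - (x, y)) = p + q := by
      simp [planeDet]
    simp only [hitTime, e1, e2] at ht0 ht1
    have hpQ : (0 : ℚ) < ((p + q : ℤ) : ℚ) := by exact_mod_cast hpq
    have hx0 : 0 < x + y := by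
      have := (div_pos_iff_of_pos_right hpQ).1 ht0
      exact_mod_cast this
    have hxp : x + y < p + q := by
      rw [div_lt_one hpQ] at ht1
      exact_mod_cast ht1
    obtain ⟨i, hi⟩ : ∃ i : ℕ, x + y - 1 = i := ⟨(x + y - 1).toNat, by omega⟩
    obtain ⟨d1, d2⟩ := div_mod_of_det (p := p) (q := q) hpq (s := i + 1) (x := x) (y := y)
      (by push_cast; omega) (by linarith) (by linarith)
    have h0 : 2 * i % 2 = 0 := by omega
    refine ⟨2 * i, by omega, ?_, ?_⟩
    · have : ¬ (2 * i) % 2 = 1 := by omega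
      simp only [crossLeft, two_mul_div_add_one, this, false_and, if_false, d1]
      ext <;> simp; omega
    · simp only [crossRight, two_mul_div_add_one, h0, true_or, if_true, d1]
      ext <;> simp; omega
  · obtain rfl : l1 = x + 1 := by omega
    obtain rfl : l2 = y - 1 := by omega
    linarith

lemma planeDet_crossRight (hpq : 0 < p + q) (j : ℕ) :
    planeDet ((p : ℤ), (q : ℤ)) (crossRight p q j) =
      if j % 2 = 0 ∨ q * (j / 2 + 1) % (p + q) < p then -((q * (j / 2 + 1) % (p + q) : ℕ) : ℤ)
      else (p : ℤ) - ((q * (j / 2 + 1) % (p + q) : ℕ) : ℤ) := by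
  have := (div_mod_spec hpq (j / 2 + 1)).1
  unfold crossRight
  split_ifs <;> simp only [planeDet] <;> linarith

lemma planeDet_crossLeft (hpq : 0 < p + q) (j : ℕ) :
    planeDet ((p : ℤ), (q : ℤ)) (crossLeft p q j) =
      if j % 2 = 1 ∧ q * (j / 2 + 1) % (p + q) < p then (p : ℤ) - ((q * (j / 2 + 1) % (p + q) : ℕ) : ℤ)
      else (p : ℤ) + q - ((q * (j / 2 + 1) % (p + q) : ℕ) : ℤ) := by
  have := (div_mod_spec hpq (j / 2 + 1)).1
  unfold crossLeft
  split_ifs <;> simp only [planeDet] <;> linarith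

/-- The ends of a diagonal segment lie on one antidiagonal, those of a side on two neighbouring
ones, so the total coordinate sum recovers the index. -/
lemma sum_crossLeft_crossRight (j : ℕ) :
    (crossLeft p q j).1 + (crossLeft p q j).2 + (crossRight p q j).1 + (crossRight p q j).2 =
      j + 2 := by
  unfold crossLeft crossRight
  split_ifs <;> simp <;> omega

lemma exists_crossing (hp : 0 < p) (hq : 0 < q) {j : ℕ} (hj : j < 2 * (p + q) - 3) :
    ∃ c : Crossing ((p : ℤ), (q : ℤ)), c.left = crossLeft p q j ∧ c.right = crossRight p q j := by
  have hpq : 0 < p + q := by omega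
  have hp' : (0 : ℤ) < p := by exact_mod_cast hp
  have hq' : (0 : ℤ) < q := by exact_mod_cast hq
  obtain ⟨hdm, hlt⟩ := div_mod_spec hpq (j / 2 + 1)
  have hl : 0 < planeDet ((p : ℤ), (q : ℤ)) (crossLeft p q j) := by
    rw [planeDet_crossLeft hpq]
    split_ifs <;> omega
  have hr : planeDet ((p : ℤ), (q : ℤ)) (crossRight p q j) ≤ 0 := by
    rw [planeDet_crossRight hpq]
    split_ifs <;> omega
  have hseg : IsLatticeSegment (crossLeft p q j) (crossRight p q j) := by
    unfold crossLeft crossRight IsLatticeSegment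
    split_ifs <;> simp <;> omega
  have ht : 0 < hitTime ((p : ℤ), (q : ℤ)) (crossLeft p q j) (crossRight p q j) ∧
      hitTime ((p : ℤ), (q : ℤ)) (crossLeft p q j) (crossRight p q j) < 1 := by
    have key : 0 < planeDet (crossRight p q j) (crossLeft p q j) ∧
        planeDet (crossRight p q j) (crossLeft p q j) <
          planeDet ((p : ℤ), (q : ℤ)) (crossLeft p q j - crossRight p q j) := by
      set i := j / 2 with hi
      unfold crossLeft crossRight
      rw [← hi]
      generalize hy : q * (i + 1) / (p + q) = y at *
      generalize hρ : q * (i + 1) % (p + q) = ρ at *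
      push_cast at hdm ⊢
      by_cases h0 : j % 2 = 0
      · have h1 : ¬ j % 2 = 1 := by omega
        simp only [h0, zero_ne_one, true_or, false_and, if_true, if_false, planeDet, Prod.fst_sub,
          Prod.snd_sub]
        constructor
        · ring_nf; positivity
        · ring_nf; omega
      · have h1 : j % 2 = 1 := by omega
        have hji : j = 2 * i + 1 := by omega
        -- An odd index is never the last one, so another antidiagonal follows before the endpoint
        -- of the curve.
        have hsmall : (i : ℤ) + 3 ≤ p + q := by omega
        by_cases h2 : ρ < p
        · simp only [h1, h2, or_true, and_self, if_true, planeDet, Prod.fst_sub,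
            Prod.snd_sub]
          have h2' : (ρ : ℤ) < p := by exact_mod_cast h2
          ring_nf
          constructor
          · by_contra hx
            have : (i : ℤ) + 1 ≤ y := by linarith
            nlinarith
          · by_contra hx
            have hx' : (p : ℤ) ≤ i + 1 - y := by linarith
            have : (y : ℤ) < q := by linarith
            nlinarith
        · simp only [h0, h2, and_false, or_self, if_false, planeDet, Prod.fst_sub,
            Prod.snd_sub]
          have h2' : (p : ℤ) ≤ ρ := by exact_mod_cast not_lt.1 h2
          ring_nf
          constructor
          · positivity
          · by_contra hx
            have hx' : (q : ℤ) ≤ y + 1 := by linarith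
            have : (i : ℤ) + 1 - y < p := by linarith
            nlinarith
    have hd : (0 : ℚ) < planeDet ((p : ℤ), (q : ℤ)) (crossLeft p q j - crossRight p q j) := by
      exact_mod_cast key.1.trans key.2
    unfold hitTime
    exact ⟨div_pos (by exact_mod_cast key.1) hd, (div_lt_one hd).2 (by exact_mod_cast key.2)⟩
  exact ⟨⟨_, _, hseg, hl, hr, ht.1, ht.2⟩, rfl, rfl⟩

end

/-! ### The order of the crossings along the curve. -/

section

variable {p q : ℕ}

/-- The place of a crossing in the order along the curve. -/
def crossIndex (c : Crossing ((p : ℤ), (q : ℤ))) : ℕ :=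
  (c.left.1 + c.left.2 + c.right.1 + c.right.2 - 2).toNat

lemma crossIndex_eq {c : Crossing ((p : ℤ), (q : ℤ))} {j : ℕ} (hl : c.left = crossLeft p q j)
    (hr : c.right = crossRight p q j) : crossIndex c = j := by
  have := sum_crossLeft_crossRight (p := p) (q := q) j
  rw [crossIndex, hl, hr, this]
  omega

lemma crossIndex_spec (hp : 0 < p) (hq : 0 < q) (c : Crossing ((p : ℤ), (q : ℤ))) :
    crossIndex c < 2 * (p + q) - 3 ∧ c.left = crossLeft p q (crossIndex c) ∧
      c.right = crossRight p q (crossIndex c) := by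
  obtain ⟨j, hj, hl, hr⟩ := exists_index hp hq c
  rw [crossIndex_eq hl hr]
  exact ⟨hj, hl, hr⟩

lemma crossIndex_injective (hp : 0 < p) (hq : 0 < q) :
    Function.Injective (crossIndex : Crossing ((p : ℤ), (q : ℤ)) → ℕ) := by
  intro c d h
  obtain ⟨-, h1, h2⟩ := crossIndex_spec hp hq c
  obtain ⟨-, h3, h4⟩ := crossIndex_spec hp hq d
  exact Crossing.ext (by rw [h1, h3, h]) (by rw [h2, h4, h])

lemma exists_crossIndex_eq (hp : 0 < p) (hq : 0 < q) {j : ℕ} (hj : j < 2 * (p + q) - 3) :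
    ∃ c : Crossing ((p : ℤ), (q : ℤ)), crossIndex c = j := by
  obtain ⟨c, hl, hr⟩ := exists_crossing hp hq hj
  exact ⟨c, crossIndex_eq hl hr⟩

/-- The position of the crossing with the `s`-th antidiagonal. -/
def diagPosition (p q s : ℕ) : ℚ ×ₗ ℚ :=
  toLex ((s : ℚ) / (p + q), ((q : ℚ) - p) / (p + q))

lemma diagPosition_lt (hp : 0 < p) {s t : ℕ} (h : s < t) :
    diagPosition p q s < diagPosition p q t := by
  rw [diagPosition, diagPosition, Prod.Lex.toLex_lt_toLex]
  left
  have : (0 : ℚ) < p + q := by positivity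
  exact div_lt_div_of_pos_right (by exact_mod_cast h) this

lemma diagPosition_le (hp : 0 < p) {s t : ℕ} (h : s ≤ t) :
    diagPosition p q s ≤ diagPosition p q t := by
  rcases h.eq_or_lt with rfl | h
  · exact le_rfl
  · exact (diagPosition_lt hp h).le

lemma hitTime_vertical (hp : 0 < p) (x y : ℤ) :
    hitTime ((p : ℤ), (q : ℤ)) (x, y + 1) (x, y) = x / p ∧
      hitDrift ((p : ℤ), (q : ℤ)) (x, y + 1) (x, y) = q / p := by
  have : (p : ℚ) ≠ 0 := by positivity
  simp only [hitTime, hitDrift, planeDet, planeDot, Prod.fst_sub, Prod.snd_sub]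
  push_cast
  constructor <;> congr 1 <;> ring

lemma hitTime_horizontal (x y : ℤ) :
    hitTime ((p : ℤ), (q : ℤ)) (x - 1, y) (x, y) = y / q ∧
      hitDrift ((p : ℤ), (q : ℤ)) (x - 1, y) (x, y) = -p / q := by
  simp only [hitTime, hitDrift, planeDet, planeDot, Prod.fst_sub, Prod.snd_sub]
  push_cast
  constructor <;> congr 1 <;> ring

lemma hitTime_diagonal (x y : ℤ) :
    hitTime ((p : ℤ), (q : ℤ)) (x - 1, y + 1) (x, y) = (x + y) / (p + q) ∧
      hitDrift ((p : ℤ), (q : ℤ)) (x - 1, y + 1) (x, y) = (q - p) / (p + q) := by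
  simp only [hitTime, hitDrift, planeDet, planeDot, Prod.fst_sub, Prod.snd_sub]
  push_cast
  constructor <;> congr 1 <;> ring

lemma position_even (hp : 0 < p) (hq : 0 < q) (c : Crossing ((p : ℤ), (q : ℤ)))
    (h : crossIndex c % 2 = 0) :
    c.position = diagPosition p q (crossIndex c / 2 + 1) := by
  obtain ⟨-, hl, hr⟩ := crossIndex_spec hp hq c
  simp only [crossLeft, crossRight, h, zero_ne_one, true_or, false_and, if_true, if_false]
    at hl hr
  generalize crossIndex c / 2 = i at *
  rw [Crossing.position, diagPosition, hl, hr, (hitTime_diagonal _ _).1, (hitTime_diagonal _ _).2]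
  congr 3
  push_cast
  ring

/-- Strictness is delicate only around a lattice point on the line: there the times coincide and the
drift, the second lexicographic coordinate, separates the crossings. -/
lemma position_odd (hp : 0 < p) (hq : 0 < q) (c : Crossing ((p : ℤ), (q : ℤ)))
    (h : crossIndex c % 2 = 1) :
    diagPosition p q (crossIndex c / 2 + 1) < c.position ∧
      c.position < diagPosition p q (crossIndex c / 2 + 2) := by
  obtain ⟨-, hl, hr⟩ := crossIndex_spec hp hq c
  have hpq : 0 < p + q := by omega
  obtain ⟨hdm, hlt⟩ := div_mod_spec hpq (crossIndex c / 2 + 1)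
  rw [Crossing.position, diagPosition, diagPosition, hl, hr]
  simp only [crossLeft, crossRight, h, one_ne_zero, true_and, false_or]
  generalize q * (crossIndex c / 2 + 1) / (p + q) = y at *
  generalize q * (crossIndex c / 2 + 1) % (p + q) = ρ at *
  generalize crossIndex c / 2 = i at *
  have hdmQ : ((p : ℚ) + q) * y + ρ = q * (i + 1) := by exact_mod_cast hdm
  have hltQ : (ρ : ℚ) < p + q := by exact_mod_cast hlt
  have hpQ : (0 : ℚ) < p := by exact_mod_cast hp
  have hqQ : (0 : ℚ) < q := by exact_mod_cast hq
  have hpqQ : (0 : ℚ) < p + q := by positivity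
  simp only [Prod.Lex.toLex_lt_toLex]
  by_cases h2 : ρ < p
  · have h2' : (ρ : ℚ) < p := by exact_mod_cast h2
    simp only [h2, if_true, (hitTime_vertical hp _ _).1, (hitTime_vertical hp _ _).2]
    push_cast
    constructor
    -- For `ρ = 0` the vertical segment and the preceding diagonal one meet the line at their common
    -- right endpoint.
    · rcases Nat.eq_zero_or_pos ρ with hρ | hρ
      · right
        subst hρ
        rw [div_eq_div_iff hpqQ.ne' hpQ.ne', div_lt_div_iff₀ hpqQ hpQ]
        push_cast at hdmQ
        constructor
        · linarith
        · nlinarith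
      · left
        have hρ' : (0 : ℚ) < ρ := by exact_mod_cast hρ
        rw [div_lt_div_iff₀ hpqQ hpQ]
        linarith
    · left
      rw [div_lt_div_iff₀ hpQ hpqQ]
      linarith
  · have h2' : (p : ℚ) ≤ ρ := by exact_mod_cast not_lt.1 h2
    simp only [h2, if_false, (hitTime_horizontal _ _).1, (hitTime_horizontal _ _).2]
    push_cast
    constructor
    · left
      rw [div_lt_div_iff₀ hpqQ hqQ]
      linarith
    -- For `ρ = p` the horizontal segment and the following diagonal one meet the line at their
    -- common right endpoint.
    · rcases h2'.eq_or_lt with hρ | hρ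
      · right
        rw [div_eq_div_iff hqQ.ne' hpqQ.ne', div_lt_div_iff₀ hqQ hpqQ]
        constructor
        · linarith
        · nlinarith
      · left
        rw [div_lt_div_iff₀ hqQ hpqQ]
        linarith

lemma position_lt (hp : 0 < p) (hq : 0 < q) {c d : Crossing ((p : ℤ), (q : ℤ))}
    (h : crossIndex c < crossIndex d) : c.position < d.position := by
  rcases Nat.mod_two_eq_zero_or_one (crossIndex c) with hc | hc <;>
    rcases Nat.mod_two_eq_zero_or_one (crossIndex d) with hd | hd
  · rw [position_even hp hq c hc, position_even hp hq d hd]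
    exact diagPosition_lt hp (by omega)
  · rw [position_even hp hq c hc]
    exact (diagPosition_le hp (by omega)).trans_lt (position_odd hp hq d hd).1
  · rw [position_even hp hq d hd]
    exact (position_odd hp hq c hc).2.trans_le (diagPosition_le hp (by omega))
  · exact (position_odd hp hq c hc).2.trans_le ((diagPosition_le hp (by omega)).trans
      (position_odd hp hq d hd).1.le)

lemma position_lt_iff (hp : 0 < p) (hq : 0 < q) (c d : Crossing ((p : ℤ), (q : ℤ))) :
    c.position < d.position ↔ crossIndex c < crossIndex d := by
  refine ⟨fun h => ?_, position_lt hp hq⟩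
  rcases lt_trichotomy (crossIndex c) (crossIndex d) with h1 | h1 | h1
  · exact h1
  · rw [crossIndex_injective hp hq h1] at h
    exact absurd h (lt_irrefl _)
  · exact absurd h (position_lt hp hq h1).not_gt

lemma consecutive_iff (hp : 0 < p) (hq : 0 < q) (c d : Crossing ((p : ℤ), (q : ℤ))) :
    c.Consecutive d ↔ crossIndex d = crossIndex c + 1 := by
  simp only [Crossing.Consecutive, position_lt_iff hp hq]
  constructor
  · rintro ⟨h1, h2⟩
    by_contra hne
    obtain ⟨e, he⟩ := exists_crossIndex_eq hp hq (j := crossIndex c + 1)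
      (by have := (crossIndex_spec hp hq d).1; omega)
    exact h2 e (by omega)
  · intro h
    exact ⟨by omega, fun e => by omega⟩

lemma closerToRight_iff (hp : 0 < p) (hq : 0 < q) (c : Crossing ((p : ℤ), (q : ℤ))) :
    c.CloserToRight ↔ chainDir p q (crossIndex c) = true := by
  obtain ⟨-, hl, hr⟩ := crossIndex_spec hp hq c
  have hpq : 0 < p + q := by omega
  obtain ⟨-, hlt⟩ := div_mod_spec hpq (crossIndex c / 2 + 1)
  rw [Crossing.CloserToRight, abs_of_nonpos c.right_nonpos, abs_of_pos c.left_pos, hl, hr,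
    planeDet_crossLeft hpq, planeDet_crossRight hpq, chainDir]
  generalize q * (crossIndex c / 2 + 1) % (p + q) = ρ at *
  generalize crossIndex c = j at *
  split_ifs <;> simp only [decide_eq_true_eq] <;> omega

lemma div_succ_of_lt (hpq : 0 < p + q) {s : ℕ} (h : q * s % (p + q) < p) :
    q * (s + 1) / (p + q) = q * s / (p + q) := by
  have h1 := Nat.div_add_mod (q * s) (p + q)
  exact ((Nat.div_mod_unique hpq).2 ⟨by linarith, by omega⟩ : _ ∧ _ = q * s % (p + q) + q).1

lemma div_succ_of_le (hpq : 0 < p + q) {s : ℕ} (h : p ≤ q * s % (p + q)) :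
    q * (s + 1) / (p + q) = q * s / (p + q) + 1 := by
  have h1 := Nat.div_add_mod (q * s) (p + q)
  have h2 := Nat.mod_lt (q * s) hpq
  refine ((Nat.div_mod_unique hpq).2 ⟨?_, by omega⟩ : _ ∧ _ = q * s % (p + q) - p).1
  rw [mul_add, mul_one, mul_add, mul_one]
  omega

/-- Consecutive segments are two sides of one lattice triangle, so they share exactly one endpoint.
The inequality for the other endpoint makes the link direction unambiguous. -/
lemma cross_succ_of_linkDir (hpq : 0 < p + q) (j : ℕ) :
    if linkDir p q j then
      crossRight p q j = crossRight p q (j + 1) ∧ crossLeft p q j ≠ crossLeft p q (j + 1)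
    else
      crossLeft p q j = crossLeft p q (j + 1) ∧ crossRight p q j ≠ crossRight p q (j + 1) := by
  rcases Nat.mod_two_eq_zero_or_one j with h | h
  · have e1 : (j + 1) % 2 = 1 := by omega
    have e2 : (j + 1) / 2 = j / 2 := by omega
    by_cases h2 : q * (j / 2 + 1) % (p + q) < p <;>
      simp [linkDir, crossLeft, crossRight, h, e1, e2, h2]
  · have e1 : (j + 1) % 2 = 0 := by omega
    have e2 : (j + 1) / 2 = j / 2 + 1 := by omega
    by_cases h2 : q * (j / 2 + 1) % (p + q) < p
    · have h3 : ¬ p ≤ q * (j / 2 + 1) % (p + q) := by omega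
      simp [linkDir, crossLeft, crossRight, h, e1, e2, h2, h3, div_succ_of_lt hpq h2]
      ring
    · have h3 : p ≤ q * (j / 2 + 1) % (p + q) := by omega
      simp [linkDir, crossLeft, crossRight, h, e1, e2, h2, h3, div_succ_of_le hpq h3]

lemma right_eq_iff (hp : 0 < p) (hq : 0 < q) {c d : Crossing ((p : ℤ), (q : ℤ))}
    (h : crossIndex d = crossIndex c + 1) :
    c.right = d.right ↔ linkDir p q (crossIndex c) = true := by
  have := cross_succ_of_linkDir (p := p) (q := q) (by omega) (crossIndex c)
  rw [(crossIndex_spec hp hq c).2.2, (crossIndex_spec hp hq d).2.2, h]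
  split_ifs at this with h1 <;> simp [h1, this]

lemma left_eq_iff (hp : 0 < p) (hq : 0 < q) {c d : Crossing ((p : ℤ), (q : ℤ))}
    (h : crossIndex d = crossIndex c + 1) :
    c.left = d.left ↔ linkDir p q (crossIndex c) = false := by
  have := cross_succ_of_linkDir (p := p) (q := q) (by omega) (crossIndex c)
  rw [(crossIndex_spec hp hq c).2.1, (crossIndex_spec hp hq d).2.1, h]
  split_ifs at this with h1 <;> simp [h1, this]

/-! ### The transfer matrix formula -/

/-- The place of an element of the fence poset in the linear arrangement of the fence. -/
def fenceIndex (k : ℕ) (x : Crossing ((p : ℤ), (q : ℤ)) × Fin (k + 1)) : ℕ :=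
  (k + 1) * crossIndex x.1 + x.2

/-- Whether the fence goes down at its `t`-th step. -/
def fenceDir (k p q t : ℕ) : Bool :=
  if t % (k + 1) < k then chainDir p q (t / (k + 1)) else linkDir p q (t / (k + 1))

lemma fenceIndex_div_mod (k : ℕ) (x : Crossing ((p : ℤ), (q : ℤ)) × Fin (k + 1)) :
    fenceIndex k x / (k + 1) = crossIndex x.1 ∧ fenceIndex k x % (k + 1) = x.2 :=
  (Nat.div_mod_unique k.add_one_pos).2 ⟨by rw [fenceIndex]; ring, x.2.2⟩

lemma fenceIndex_injective (hp : 0 < p) (hq : 0 < q) (k : ℕ) :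
    Function.Injective (fenceIndex k : Crossing ((p : ℤ), (q : ℤ)) × Fin (k + 1) → ℕ) := by
  intro x y h
  have hx := fenceIndex_div_mod k x
  have hy := fenceIndex_div_mod k y
  rw [h] at hx
  exact Prod.ext (crossIndex_injective hp hq (hx.1.symm.trans hy.1))
    (Fin.ext (hx.2.symm.trans hy.2))

/-- This identifies the poset with a zigzag on consecutive integers, the form required by
`lowerSets_ncard`. -/
lemma fenceRel_iff (hp : 0 < p) (hq : 0 < q) (k : ℕ)
    (x y : Crossing ((p : ℤ), (q : ℤ)) × Fin (k + 1)) :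
    FenceRel k (p, q) x y ↔
      (fenceIndex k x = fenceIndex k y + 1 ∧ fenceDir k p q (fenceIndex k y) = true) ∨
        (fenceIndex k y = fenceIndex k x + 1 ∧ fenceDir k p q (fenceIndex k x) = false) := by
  have succ_cases : ∀ x y : Crossing ((p : ℤ), (q : ℤ)) × Fin (k + 1),
      fenceIndex k y = fenceIndex k x + 1 →
        (y.1 = x.1 ∧ ∃ i : Fin k, x.2 = i.castSucc ∧ y.2 = i.succ) ∨
          (crossIndex y.1 = crossIndex x.1 + 1 ∧ x.2 = Fin.last k ∧ y.2 = 0) := by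
    rintro ⟨c, i⟩ ⟨d, j⟩ h
    have hy := fenceIndex_div_mod k (d, j)
    rw [h] at hy
    by_cases hi : (i : ℕ) < k
    · have := (Nat.div_mod_unique (k.add_one_pos)
        (a := fenceIndex k (c, i) + 1) (c := i + 1) (d := crossIndex c)).2
        ⟨by rw [fenceIndex]; ring, by omega⟩
      left
      refine ⟨crossIndex_injective hp hq (hy.1.symm.trans this.1), ⟨i, hi⟩, rfl, Fin.ext ?_⟩
      exact hy.2.symm.trans this.2
    · have hik : (i : ℕ) = k := by omega
      have := (Nat.div_mod_unique (k.add_one_pos)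
        (a := fenceIndex k (c, i) + 1) (c := 0) (d := crossIndex c + 1)).2
        ⟨by rw [fenceIndex]; simp only [hik]; ring, by omega⟩
      right
      exact ⟨hy.1.symm.trans this.1, Fin.ext hik, Fin.ext (hy.2.symm.trans this.2)⟩
  have dir_chain : ∀ (c : Crossing ((p : ℤ), (q : ℤ))) (i : Fin k),
      fenceDir k p q (fenceIndex k (c, i.castSucc)) = chainDir p q (crossIndex c) := by
    intro c i
    have := fenceIndex_div_mod k (c, i.castSucc)
    rw [fenceDir, this.1, this.2, if_pos (by simp)]
  have dir_link : ∀ (c : Crossing ((p : ℤ), (q : ℤ))),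
      fenceDir k p q (fenceIndex k (c, Fin.last k)) = linkDir p q (crossIndex c) := by
    intro c
    have := fenceIndex_div_mod k (c, Fin.last k)
    rw [fenceDir, this.1, this.2, if_neg (by simp)]
  have idx_link : ∀ (c d : Crossing ((p : ℤ), (q : ℤ))), crossIndex d = crossIndex c + 1 →
      fenceIndex k (d, 0) = fenceIndex k (c, Fin.last k) + 1 := by
    intro c d h
    simp only [fenceIndex, h, Fin.val_last, Fin.val_zero]
    ring
  constructor
  · rintro (⟨c, i, h⟩ | ⟨c, i, h⟩ | ⟨c, d, h, h'⟩ | ⟨c, d, h, h'⟩)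
    · left
      rw [dir_chain]
      exact ⟨by simp [fenceIndex]; ring, (closerToRight_iff hp hq c).1 h⟩
    · right
      rw [dir_chain]
      exact ⟨by simp [fenceIndex]; ring, by simpa [closerToRight_iff hp hq c] using h⟩
    · rw [consecutive_iff hp hq] at h
      left
      rw [dir_link]
      exact ⟨idx_link c d h, (right_eq_iff hp hq h).1 h'⟩
    · rw [consecutive_iff hp hq] at h
      right
      rw [dir_link]
      exact ⟨idx_link c d h, (left_eq_iff hp hq h).1 h'⟩
  · rintro (⟨h1, h2⟩ | ⟨h1, h2⟩)
    · obtain ⟨c, i⟩ := x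
      obtain ⟨d, j⟩ := y
      rcases succ_cases _ _ h1 with ⟨h3, i', h4, h5⟩ | ⟨h3, h4, h5⟩
      · dsimp only at h3 h4 h5
        subst h3 h4 h5
        rw [dir_chain] at h2
        exact .chainDown _ _ ((closerToRight_iff hp hq _).2 h2)
      · dsimp only at h3 h4 h5
        subst h4 h5
        rw [dir_link] at h2
        exact .linkDown _ _ ((consecutive_iff hp hq _ _).2 h3) ((right_eq_iff hp hq h3).2 h2)
    · obtain ⟨c, i⟩ := x
      obtain ⟨d, j⟩ := y
      rcases succ_cases _ _ h1 with ⟨h3, i', h4, h5⟩ | ⟨h3, h4, h5⟩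
      · dsimp only at h3 h4 h5
        subst h3 h4 h5
        rw [dir_chain] at h2
        exact .chainUp _ _ (by rw [closerToRight_iff hp hq, h2]; simp)
      · dsimp only at h3 h4 h5
        subst h4 h5
        rw [dir_link] at h2
        exact .linkUp _ _ ((consecutive_iff hp hq _ _).2 h3) ((left_eq_iff hp hq h3).2 h2)

lemma genMarkov_eq_fence (hp : 0 < p) (hq : 0 < q) (k : ℕ) :
    (genMarkov k p q : ℝ) = entrySum (seqProd (fun t => stepMatrix (fenceDir k p q t))
      ((k + 1) * (2 * (p + q) - 4) + k)) := by
  have hn : 2 * (p + q) - 3 = 2 * (p + q) - 4 + 1 := by omega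
  refine lowerSets_ncard (FenceRel k (p, q)) _ (fenceIndex k) (fenceIndex_injective hp hq k)
    ?_ ?_ _ (fenceRel_iff hp hq k)
  · rintro ⟨c, i⟩
    have h1 := (crossIndex_spec hp hq c).1
    rw [hn, Nat.lt_succ_iff] at h1
    have h2 := Nat.mul_le_mul_left (k + 1) h1
    have h3 := i.2
    rw [fenceIndex]
    dsimp only
    omega
  · intro t ht
    have h1 : t / (k + 1) < 2 * (p + q) - 3 := by
      rw [hn, Nat.div_lt_iff_lt_mul k.add_one_pos]
      ring_nf at ht ⊢
      omega
    obtain ⟨c, hc⟩ := exists_crossIndex_eq hp hq h1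
    refine ⟨(c, ⟨t % (k + 1), Nat.mod_lt _ k.add_one_pos⟩), ?_⟩
    rw [fenceIndex]
    dsimp only
    rw [hc]
    exact Nat.div_add_mod t (k + 1)

/-! ### Grouping the steps by crossings and by antidiagonals. -/

/-- The transfer matrix of the chain on one crossed segment. -/
def chainMatrix (k : ℕ) (down : Bool) : Matrix (Fin 2) (Fin 2) ℝ := stepMatrix down ^ k

/-- Each crossing contributes `k` chain steps and one outgoing link, except the last, which has no
link. -/
lemma genMarkov_eq_cross (hp : 0 < p) (hq : 0 < q) (k : ℕ) :
    (genMarkov k p q : ℝ) = entrySum (seqProd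
      (fun j => chainMatrix k (chainDir p q j) * stepMatrix (linkDir p q j)) (2 * (p + q) - 4) *
        chainMatrix k (chainDir p q (2 * (p + q) - 4))) := by
  have hdm : ∀ j i, i < k + 1 → ((k + 1) * j + i) / (k + 1) = j ∧
      ((k + 1) * j + i) % (k + 1) = i := fun j i hi =>
    (Nat.div_mod_unique k.add_one_pos).2 ⟨by ring, hi⟩
  have hchain : ∀ j, seqProd (fun i => stepMatrix (fenceDir k p q ((k + 1) * j + i))) k =
      chainMatrix k (chainDir p q j) := by
    intro j
    rw [chainMatrix, ← seqProd_const]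
    refine seqProd_congr fun i hi => ?_
    rw [fenceDir, (hdm j i (by omega)).1, (hdm j i (by omega)).2, if_pos hi]
  rw [genMarkov_eq_fence hp hq, seqProd_add, seqProd_mul, hchain]
  congr 2
  refine seqProd_congr fun j _ => ?_
  rw [seqProd_succ, hchain, fenceDir, (hdm j k (by omega)).1, (hdm j k (by omega)).2,
    if_neg (lt_irrefl k)]

/-- The transfer matrix of the crossing with the `s`-th antidiagonal, where `ρ` is minus the
determinant of its right endpoint. -/
def diagMatrix (k p q ρ : ℕ) : Matrix (Fin 2) (Fin 2) ℝ :=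
  chainMatrix k (decide (2 * ρ < p + q))

/-- The transfer matrix of the horizontal or vertical crossing between two antidiagonals, with its
two links. -/
def sideMatrix (k p q ρ : ℕ) : Matrix (Fin 2) (Fin 2) ℝ :=
  if ρ < p then stepMatrix true * chainMatrix k (decide (2 * ρ < p)) * stepMatrix false
  else stepMatrix false * chainMatrix k (decide (2 * ρ < 2 * p + q)) * stepMatrix true

/-- The transfer matrix of the crossings from the `s`-th antidiagonal up to the next one. -/
def cellMatrix (k p q s : ℕ) : Matrix (Fin 2) (Fin 2) ℝ :=
  diagMatrix k p q (q * s % (p + q)) * sideMatrix k p q (q * s % (p + q))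

/-- The transfer matrix of the fence of `(p, q)`. -/
def fenceMatrix (k p q : ℕ) : Matrix (Fin 2) (Fin 2) ℝ :=
  seqProd (fun i => cellMatrix k p q (i + 1)) (p + q - 2) *
    diagMatrix k p q (q * (p + q - 1) % (p + q))

lemma genMarkov_eq (hp : 0 < p) (hq : 0 < q) (k : ℕ) :
    (genMarkov k p q : ℝ) = entrySum (fenceMatrix k p q) := by
  have h0 : ∀ i, 2 * i % 2 = 0 := fun i => by omega
  have h1 : ∀ i, ¬ (2 * i + 1) % 2 = 0 := fun i => by omega
  have h2 : 2 * (p + q) - 4 = 2 * (p + q - 2) := by omega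
  have h3 : p + q - 2 + 1 = p + q - 1 := by omega
  rw [genMarkov_eq_cross hp hq, fenceMatrix, h2, seqProd_mul]
  congr 2
  · refine seqProd_congr fun i _ => ?_
    simp only [seqProd_succ, seqProd_zero, one_mul, add_zero, chainDir, linkDir, h0, h1, if_true,
      if_false, two_mul_div_add_one, two_mul_add_one_div_add_one, cellMatrix, diagMatrix,
      sideMatrix]
    by_cases h : q * (i + 1) % (p + q) < p
    · simp [h, not_le.2 h, mul_assoc]
    · simp [h, not_lt.1 h, mul_assoc]
  · simp [chainDir, diagMatrix, h3]

end

/-! ### Multiples of a vector -/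

lemma chainMatrix_true (k : ℕ) : chainMatrix k true = !![1, (k : ℝ); 0, 1] := by
  induction k with
  | zero => simp [chainMatrix, Matrix.one_fin_two]
  | succ k ih =>
    have : chainMatrix (k + 1) true = chainMatrix k true * stepMatrix true := pow_succ _ _
    rw [this, ih, stepMatrix, if_pos rfl, Matrix.mul_fin_two]
    ext i j
    fin_cases i <;> fin_cases j <;> simp [add_comm]

lemma chainMatrix_false (k : ℕ) : chainMatrix k false = !![1, 0; (k : ℝ), 1] := by
  induction k with
  | zero => simp [chainMatrix, Matrix.one_fin_two]
  | succ k ih =>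
    have : chainMatrix (k + 1) false = chainMatrix k false * stepMatrix false := pow_succ _ _
    rw [this, ih, stepMatrix, if_neg Bool.false_ne_true, Matrix.mul_fin_two]
    ext i j
    fin_cases i <;> fin_cases j <;> simp

lemma stepMatrix_true : stepMatrix true = !![1, 1; 0, 1] := if_pos rfl

lemma stepMatrix_false : stepMatrix false = !![1, 0; 1, 1] := if_neg Bool.false_ne_true

lemma det_stepMatrix (b : Bool) : (stepMatrix b).det = 1 := by
  cases b <;> simp [stepMatrix_true, stepMatrix_false, Matrix.det_fin_two]

lemma det_chainMatrix (k : ℕ) (b : Bool) : (chainMatrix k b).det = 1 := by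
  simp [chainMatrix, det_stepMatrix]

lemma det_seqProd (f : ℕ → Matrix (Fin 2) (Fin 2) ℝ) (h : ∀ i, (f i).det = 1) (n : ℕ) :
    (seqProd f n).det = 1 := by
  induction n with
  | zero => simp
  | succ n ih => rw [seqProd_succ, Matrix.det_mul, ih, h, one_mul]

lemma det_fenceMatrix (k p q : ℕ) : (fenceMatrix k p q).det = 1 := by
  have h : ∀ s, (cellMatrix k p q s).det = 1 := by
    intro s
    rw [cellMatrix, diagMatrix, sideMatrix]
    split_ifs <;> simp [det_stepMatrix, det_chainMatrix]
  rw [fenceMatrix, Matrix.det_mul, det_seqProd _ fun i => h _, diagMatrix, det_chainMatrix,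
    one_mul]

/-- The transfer matrix of the three crossings on a detour around a lattice point on the line. -/
def detourMatrix (k : ℕ) : Matrix (Fin 2) (Fin 2) ℝ :=
  !![3 * (k : ℝ) + 3, 3 * k + 2; 3 * k + 4, 3 * k + 3]

/-- The remainder and all thresholds it is compared with are multiplied by `d`, so a cell depends
only on the direction of the vector. -/
lemma cellMatrix_scale (k a b : ℕ) {d : ℕ} (hd : 0 < d) (s : ℕ) :
    cellMatrix k (d * a) (d * b) s = cellMatrix k a b s := by
  have e1 : d * b * s % (d * (a + b)) = d * (b * s % (a + b)) := by
    rw [mul_assoc, Nat.mul_mod_mul_left]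
  have e2 : ∀ x y : ℕ, d * x < d * y ↔ x < y := fun x y => Nat.mul_lt_mul_left hd
  simp only [cellMatrix, diagMatrix, sideMatrix, e1, ← mul_add, mul_left_comm 2 d, e2]

lemma diagMatrix_scale (k a b : ℕ) {d : ℕ} (hd : 0 < d) (s : ℕ) :
    diagMatrix k (d * a) (d * b) (d * b * s % (d * a + d * b)) =
      diagMatrix k a b (b * s % (a + b)) := by
  have e1 : d * b * s % (d * (a + b)) = d * (b * s % (a + b)) := by
    rw [mul_assoc, Nat.mul_mod_mul_left]
  have e2 : ∀ x y : ℕ, d * x < d * y ↔ x < y := fun x y => Nat.mul_lt_mul_left hd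
  simp only [diagMatrix, e1, ← mul_add, mul_left_comm 2 d, e2]

lemma mul_add_period_mod (b e s : ℕ) : b * (s + e) % e = b * s % e := by
  rw [mul_add, Nat.add_mul_mod_self_right]

lemma cellMatrix_period (k a b s : ℕ) : cellMatrix k a b (s + (a + b)) = cellMatrix k a b s := by
  simp only [cellMatrix, mul_add_period_mod]

/-- The period ends with the passage around a lattice point: a horizontal, a diagonal and a vertical
crossing, all with their right endpoint on the line, hence with descending chains. Splitting off
these three and their four links leaves the fence of `(a, b)`. -/
lemma seqProd_cell_period (k : ℕ) {a b : ℕ} (ha : 0 < a) (hb : 0 < b) :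
    seqProd (fun i => cellMatrix k a b (i + 1)) (a + b) =
      fenceMatrix k a b * detourMatrix k := by
  obtain ⟨e, he⟩ : ∃ e, a + b = e + 2 := ⟨a + b - 2, by omega⟩
  -- Modulo `a + b`, `b * (a + b - 1)` is `-b`, that is `a`: the horizontal case with its right
  -- endpoint on the line.
  have h1 : b * (e + 1) % (e + 2) = a := by
    have : b * (e + 1) = a + (e + 2) * (b - 1) := by
      obtain ⟨c, rfl⟩ : ∃ c, b = c + 1 := ⟨b - 1, by omega⟩
      obtain rfl : e = a + c - 1 := by omega
      obtain ⟨f, rfl⟩ : ∃ f, a = f + 1 := ⟨a - 1, by omega⟩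
      simp only [Nat.add_sub_cancel, show f + 1 + c - 1 = f + c by omega]
      ring
    rw [this, Nat.add_mul_mod_self_left, Nat.mod_eq_of_lt (by omega)]
  have h2 : cellMatrix k a b (e + 1) = diagMatrix k a b (b * (e + 1) % (e + 2)) *
      (stepMatrix false * chainMatrix k true * stepMatrix true) := by
    rw [cellMatrix, he, h1, sideMatrix, if_neg (lt_irrefl a), decide_eq_true (by omega)]
  have h3 : cellMatrix k a b (e + 1 + 1) =
      chainMatrix k true * (stepMatrix true * chainMatrix k true * stepMatrix false) := by
    have : b * (e + 1 + 1) % (a + b) = 0 := by rw [he]; exact Nat.mul_mod_left _ _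
    rw [cellMatrix, this, diagMatrix, sideMatrix, if_pos ha, decide_eq_true (by omega),
      decide_eq_true (by omega)]
  have h4 : stepMatrix false * chainMatrix k true * stepMatrix true *
      (chainMatrix k true * (stepMatrix true * chainMatrix k true * stepMatrix false)) =
        detourMatrix k := by
    simp only [stepMatrix_true, stepMatrix_false, chainMatrix_true, detourMatrix,
      Matrix.mul_fin_two]
    ext i j
    fin_cases i <;> fin_cases j <;> simp <;> ring
  rw [he, seqProd_succ, seqProd_succ, h2, h3, fenceMatrix, he, ← h4]
  simp only [Nat.add_sub_cancel, show e + 2 - 1 = e + 1 from rfl, mul_assoc]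

lemma fenceMatrix_multiple (k : ℕ) {a b : ℕ} (ha : 0 < a) (hb : 0 < b) (d : ℕ) :
    fenceMatrix k ((d + 1) * a) ((d + 1) * b) =
      (fenceMatrix k a b * detourMatrix k) ^ d * fenceMatrix k a b := by
  have scaled : ∀ d, fenceMatrix k ((d + 1) * a) ((d + 1) * b) =
      seqProd (fun i => cellMatrix k a b (i + 1)) ((d + 1) * (a + b) - 2) *
        diagMatrix k a b (b * ((d + 1) * (a + b) - 1) % (a + b)) := by
    intro d
    rw [fenceMatrix, diagMatrix_scale k a b d.succ_pos, ← mul_add]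
    simp only [cellMatrix_scale k a b d.succ_pos]
  induction d with
  | zero => simp
  | succ d ih =>
    have hge : a + b ≤ (d + 1) * (a + b) := Nat.le_mul_of_pos_left _ d.succ_pos
    have e1 : (d + 1 + 1) * (a + b) - 2 = (a + b) + ((d + 1) * (a + b) - 2) := by
      rw [add_one_mul (d + 1)]; omega
    have e2 : (d + 1 + 1) * (a + b) - 1 = ((d + 1) * (a + b) - 1) + (a + b) := by
      rw [add_one_mul (d + 1)]; omega
    have e3 : ∀ i, cellMatrix k a b (a + b + i + 1) = cellMatrix k a b (i + 1) := by
      intro i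
      rw [← cellMatrix_period k a b (i + 1)]
      congr 1
      ring
    rw [scaled, e1, e2, mul_add_period_mod, seqProd_add, seqProd_cell_period k ha hb]
    simp only [e3]
    rw [mul_assoc (_ * _), ← scaled, ih, pow_succ', mul_assoc (_ * _)]

/-- Cayley–Hamilton in size two. -/
lemma mul_self_of_det_eq_one {N : Matrix (Fin 2) (Fin 2) ℝ} (h : N.det = 1) :
    N * N = N.trace • N - 1 := by
  rw [Matrix.det_fin_two] at h
  ext i j
  fin_cases i <;> fin_cases j <;>
    simp [Matrix.mul_apply, Fin.sum_univ_two, Matrix.trace_fin_two] <;> linarith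

lemma entrySum_add (M N : Matrix (Fin 2) (Fin 2) ℝ) :
    entrySum (M + N) = entrySum M + entrySum N := by
  simp only [entrySum, Matrix.add_apply]; ring

lemma entrySum_sub (M N : Matrix (Fin 2) (Fin 2) ℝ) :
    entrySum (M - N) = entrySum M - entrySum N := by
  simp only [entrySum, Matrix.sub_apply]; ring

lemma entrySum_smul (r : ℝ) (M : Matrix (Fin 2) (Fin 2) ℝ) :
    entrySum (r • M) = r * entrySum M := by
  simp only [entrySum, Matrix.smul_apply, smul_eq_mul]; ring

/-- Chebyshev-like values: the numbers of a multiple vector in terms of that of the vector. -/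
def chebValue (k : ℕ) (m : ℝ) : ℕ → ℝ
  | 0 => m
  | 1 => ((3 + 3 * k) * m - k) * m
  | d + 2 => ((3 + 3 * k) * m - k) * chebValue k m (d + 1) - chebValue k m d

/-- With `D = (3k+3) J + W`, `W = !![0, -1; 1, 0]`, the part `J` turns both the trace of `M * D` and
the entry sum of `M * D * M` into expressions in the entry sum of `M`. The part `W` contributes only
through `M 0 1 - M 1 0`. -/
lemma entrySum_pow_mul (k : ℕ) {M : Matrix (Fin 2) (Fin 2) ℝ} (hdet : M.det = 1)
    (hM : M 0 1 - M 1 0 = -(k : ℝ)) (d : ℕ) :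
    entrySum ((M * detourMatrix k) ^ d * M) = chebValue k (entrySum M) d := by
  have htr : (M * detourMatrix k).trace = (3 + 3 * k) * entrySum M - k := by
    rw [sub_eq_add_neg, ← hM]
    simp only [Matrix.trace_fin_two, Matrix.mul_apply, Fin.sum_univ_two, detourMatrix, entrySum]
    simp
    ring
  have hd : (M * detourMatrix k).det = 1 := by
    rw [Matrix.det_mul, hdet, detourMatrix, Matrix.det_fin_two_of]
    ring
  have hsq := mul_self_of_det_eq_one hd
  rw [htr] at hsq
  induction d using Nat.twoStepInduction with
  | zero => simp [chebValue]
  | one =>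
    rw [pow_one, chebValue, sub_eq_add_neg _ (k : ℝ), ← hM]
    simp only [Matrix.mul_apply, Fin.sum_univ_two, detourMatrix, entrySum]
    simp
    ring
  | more d ih1 ih2 =>
    have : (M * detourMatrix k) ^ (d + 2) * M =
        ((3 + 3 * k) * entrySum M - k) • ((M * detourMatrix k) ^ (d + 1) * M) -
          (M * detourMatrix k) ^ d * M := by
      rw [pow_add, pow_two, hsq, mul_sub, mul_one, sub_mul, mul_smul_comm, smul_mul_assoc,
        ← pow_succ]
    rw [this, entrySum_sub, entrySum_smul, ih1, ih2, chebValue]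

lemma genMarkov_multiple (k : ℕ) {a b : ℕ} (ha : 0 < a) (hb : 0 < b)
    (hM : fenceMatrix k a b 0 1 - fenceMatrix k a b 1 0 = -(k : ℝ)) (d : ℕ) :
    (genMarkov k ((d + 1 : ℕ) * a) ((d + 1 : ℕ) * b) : ℝ) =
      chebValue k (genMarkov k a b) d := by
  rw [genMarkov_eq ha hb, ← entrySum_pow_mul k (det_fenceMatrix k a b) hM,
    ← fenceMatrix_multiple k ha hb, ← genMarkov_eq (by positivity) (by positivity)]
  push_cast
  rfl

/-! ### The two families of vectors -/

/-- Congruence by `P` multiplies the antisymmetric part of a matrix of size two by `det P`. -/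
lemma antisymm_conj {P M : Matrix (Fin 2) (Fin 2) ℝ} (hP : P.det = 1) :
    (P * M * P.transpose) 0 1 - (P * M * P.transpose) 1 0 = M 0 1 - M 1 0 := by
  have h : (P * M * P.transpose) 0 1 - (P * M * P.transpose) 1 0 = P.det * (M 0 1 - M 1 0) := by
    simp only [Matrix.mul_apply, Fin.sum_univ_two, Matrix.transpose_apply, Matrix.det_fin_two]
    ring
  rw [h, hP, one_mul]

/-- A sequence of matrices given by conjugation with period two satisfies a linear recursion as
soon as its first terms do. -/
lemma conj_recursion {P K : Matrix (Fin 2) (Fin 2) ℝ} {t : ℝ}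
    {A : ℕ → Matrix (Fin 2) (Fin 2) ℝ} (hA : ∀ m, A (m + 2) = P * A m * P.transpose)
    (hK : P * K * P.transpose = K) (h0 : A 2 = t • A 1 - A 0 + K) (h1 : A 3 = t • A 2 - A 1 + K)
    (m : ℕ) : A (m + 2) = t • A (m + 1) - A m + K := by
  induction m using Nat.twoStepInduction with
  | zero => exact h0
  | one => exact h1
  | more m ih _ =>
    have := congrArg (fun X => P * X * P.transpose) ih
    simpa only [mul_add, mul_sub, add_mul, sub_mul, mul_smul_comm, smul_mul_assoc, hK,
      ← hA] using this

/-- The matrix prolonging the fence of `(n, 1)` to that of `(n + 2, 1)`. -/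
def horizontalMatrix (k : ℕ) : Matrix (Fin 2) (Fin 2) ℝ := !![2 * (k : ℝ) + 2, 2 * k + 1; 1, 1]

/-- The matrix prolonging the fence of `(n + 1, n)` to that of `(n + 3, n + 2)`. -/
def diagonalMatrix (k : ℕ) : Matrix (Fin 2) (Fin 2) ℝ :=
  !![3 * (k : ℝ) ^ 2 + 5 * k + 3, 3 * (k : ℝ) ^ 2 + 6 * k + 4; 3 * k + 2, 3 * k + 3]

/-- One cell of the fence of `(n, 1)`. -/
def horizontalCell (k n i : ℕ) : Matrix (Fin 2) (Fin 2) ℝ :=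
  chainMatrix k (decide (2 * (i + 1) < n + 1)) *
    (stepMatrix true * chainMatrix k (decide (2 * (i + 1) < n)) * stepMatrix false)

lemma fenceMatrix_horizontal (k n : ℕ) :
    fenceMatrix k (n + 1) 1 = seqProd (horizontalCell k (n + 1)) n *
      chainMatrix k (decide (2 * (n + 1) < n + 2)) := by
  rw [fenceMatrix, diagMatrix]
  simp only [Nat.add_sub_cancel, one_mul, show n + 1 + 1 - 2 = n by omega]
  rw [Nat.mod_eq_of_lt (Nat.lt_succ_self (n + 1))]
  congr 1
  refine seqProd_congr fun i hi => ?_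
  rw [cellMatrix, one_mul, Nat.mod_eq_of_lt (by omega), diagMatrix, sideMatrix,
    if_pos (by omega), horizontalCell]

/-- The thresholds move along with the shift by one cell, so the old fence sits in the middle of the
new one. The added front has only descending chains and the added back only ascending ones, which
makes the back factor the transpose of the front factor. -/
lemma fenceMatrix_horizontal_add_two (k n : ℕ) :
    fenceMatrix k (n + 2 + 1) 1 = horizontalMatrix k * fenceMatrix k (n + 1) 1 *
      (horizontalMatrix k).transpose := by
  have h1 : ∀ i, horizontalCell k (n + 2 + 1) (i + 1) = horizontalCell k (n + 1) i := by
    intro i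
    rw [horizontalCell, horizontalCell]
    congr 2
    · exact decide_eq_decide.2 (by omega)
    · congr 2
      exact decide_eq_decide.2 (by omega)
  have h2 : horizontalCell k (n + 2 + 1) 0 = horizontalMatrix k := by
    rw [horizontalCell, decide_eq_true (by omega), decide_eq_true (by omega)]
    simp only [stepMatrix_true, stepMatrix_false, chainMatrix_true, horizontalMatrix,
      Matrix.mul_fin_two]
    ext i j
    fin_cases i <;> fin_cases j <;> simp <;> ring
  have h3 : stepMatrix true * chainMatrix k false * stepMatrix false * chainMatrix k false =
      (horizontalMatrix k).transpose := by
    simp only [stepMatrix_true, stepMatrix_false, chainMatrix_false, horizontalMatrix,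
      Matrix.mul_fin_two]
    ext i j
    fin_cases i <;> fin_cases j <;> simp <;> ring
  rw [fenceMatrix_horizontal, fenceMatrix_horizontal, seqProd_succ', h2]
  simp only [h1]
  rw [seqProd_succ, ← h3, horizontalCell,
    decide_eq_false (show ¬ 2 * (n + 1) < n + 1 by omega),
    decide_eq_false (show ¬ 2 * (n + 2 + 1) < n + 2 + 2 by omega)]
  simp only [mul_assoc]

/-- One pair of cells of the fence of `(n + 1, n)`. -/
def diagonalCell (k n j : ℕ) : Matrix (Fin 2) (Fin 2) ℝ :=
  chainMatrix k true *
      (stepMatrix true * chainMatrix k (decide (2 * (n - j) < n + 1)) * stepMatrix false) *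
    (chainMatrix k false *
      (stepMatrix false * chainMatrix k (decide (2 * (2 * n - j) < 3 * n + 2)) * stepMatrix true))

/-- Multiplication by `n + 1` modulo `2n + 3` sends `2j + 1` to `n + 1 - j` and `2j + 2` to `2(n +
1) - j`, so vertical and horizontal crossings alternate and cells come in pairs. -/
lemma fenceMatrix_diagonal (k n : ℕ) :
    fenceMatrix k (n + 1 + 1) (n + 1) = seqProd (diagonalCell k (n + 1)) n *
      (chainMatrix k true * (stepMatrix true * chainMatrix k (decide (2 < n + 2)) *
        stepMatrix false) * chainMatrix k false) := by
  have odd_mod : ∀ j ≤ n, (n + 1) * (2 * j + 1) % (n + 1 + 1 + (n + 1)) = n + 1 - j := by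
    intro j hj
    obtain ⟨r, rfl⟩ := Nat.exists_eq_add_of_le hj
    have : (j + r + 1) * (2 * j + 1) = (j + r + 1 - j) + (j + r + 1 + 1 + (j + r + 1)) * j := by
      rw [show j + r + 1 - j = r + 1 by omega]; ring
    rw [this, Nat.add_mul_mod_self_left, Nat.mod_eq_of_lt (by omega)]
  have even_mod : ∀ j ≤ n, (n + 1) * (2 * j + 1 + 1) % (n + 1 + 1 + (n + 1)) =
      2 * (n + 1) - j := by
    intro j hj
    obtain ⟨r, rfl⟩ := Nat.exists_eq_add_of_le hj
    have : (j + r + 1) * (2 * j + 1 + 1) =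
        (2 * (j + r + 1) - j) + (j + r + 1 + 1 + (j + r + 1)) * j := by
      rw [show 2 * (j + r + 1) - j = j + 2 * r + 2 by omega]; ring
    rw [this, Nat.add_mul_mod_self_left, Nat.mod_eq_of_lt (by omega)]
  have odd_cell : ∀ j ≤ n, cellMatrix k (n + 1 + 1) (n + 1) (2 * j + 1) = chainMatrix k true *
      (stepMatrix true * chainMatrix k (decide (2 * (n + 1 - j) < n + 1 + 1)) *
        stepMatrix false) := by
    intro j hj
    rw [cellMatrix, odd_mod j hj, diagMatrix, sideMatrix, if_pos (by omega),
      decide_eq_true (by omega)]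
  have even_diag : ∀ j ≤ n, diagMatrix k (n + 1 + 1) (n + 1)
      ((n + 1) * (2 * j + 1 + 1) % (n + 1 + 1 + (n + 1))) = chainMatrix k false := by
    intro j hj
    rw [even_mod j hj, diagMatrix, decide_eq_false (by omega)]
  have hlast : n + 1 + 1 + (n + 1) - 1 = 2 * n + 1 + 1 := by omega
  have hnum : n + 1 + 1 + (n + 1) - 2 = 2 * n + 1 := by omega
  rw [fenceMatrix, hlast, even_diag n le_rfl, hnum, seqProd_succ, odd_cell n le_rfl, seqProd_mul,
    show n + 1 - n = 1 by omega, mul_assoc (seqProd _ n)]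
  congr 1
  refine seqProd_congr fun j hj => ?_
  simp only [seqProd_succ, seqProd_zero, one_mul, add_zero]
  rw [odd_cell j hj.le, cellMatrix, even_diag j hj.le, even_mod j hj.le, sideMatrix,
    if_neg (by omega), diagonalCell,
    show 2 * (n + 1 + 1) + (n + 1) = 3 * (n + 1) + 2 by ring]

lemma fenceMatrix_diagonal_add_two (k n : ℕ) :
    fenceMatrix k (n + 2 + 1 + 1) (n + 2 + 1) = diagonalMatrix k *
      fenceMatrix k (n + 1 + 1) (n + 1) * (diagonalMatrix k).transpose := by
  have h1 : ∀ i < n + 1, diagonalCell k (n + 2 + 1) (i + 1) = diagonalCell k (n + 1) i := by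
    intro i hi
    rw [diagonalCell, diagonalCell,
      decide_eq_decide.2 (show 2 * (n + 2 + 1 - (i + 1)) < n + 2 + 1 + 1 ↔
        2 * (n + 1 - i) < n + 1 + 1 by omega),
      decide_eq_decide.2 (show 2 * (2 * (n + 2 + 1) - (i + 1)) < 3 * (n + 2 + 1) + 2 ↔
        2 * (2 * (n + 1) - i) < 3 * (n + 1) + 2 by omega)]
  have h2 : diagonalCell k (n + 2 + 1) 0 = diagonalMatrix k := by
    rw [diagonalCell, decide_eq_false (by omega), decide_eq_false (by omega)]
    simp only [stepMatrix_true, stepMatrix_false, chainMatrix_true, chainMatrix_false,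
      diagonalMatrix, Matrix.mul_fin_two]
    ext i j
    fin_cases i <;> fin_cases j <;> simp <;> ring
  have h3 : stepMatrix false * chainMatrix k true * stepMatrix true *
      (chainMatrix k true * (stepMatrix true * chainMatrix k true * stepMatrix false) *
        chainMatrix k false) = (diagonalMatrix k).transpose := by
    simp only [stepMatrix_true, stepMatrix_false, chainMatrix_true, chainMatrix_false,
      diagonalMatrix, Matrix.mul_fin_two]
    ext i j
    fin_cases i <;> fin_cases j <;> simp <;> ring
  have h4 : decide (2 * (n + 1 - n) < n + 1 + 1) = decide (2 < n + 2) :=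
    decide_eq_decide.2 (by omega)
  rw [fenceMatrix_diagonal, fenceMatrix_diagonal, seqProd_succ', h2, seqProd_congr h1,
    seqProd_succ, ← h3, diagonalCell,
    decide_eq_true (show 2 * (2 * (n + 1) - n) < 3 * (n + 1) + 2 by omega),
    decide_eq_true (show 2 < n + 2 + 2 by omega), h4]
  simp only [mul_assoc]

lemma entrySum_conj_recursion {P K : Matrix (Fin 2) (Fin 2) ℝ} {t : ℝ}
    {A : ℕ → Matrix (Fin 2) (Fin 2) ℝ} (hA : ∀ m, A (m + 2) = P * A m * P.transpose)
    (hK : P * K * P.transpose = K) (h0 : A 2 = t • A 1 - A 0 + K) (h1 : A 3 = t • A 2 - A 1 + K)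
    (m : ℕ) : entrySum (A (m + 2)) = t * entrySum (A (m + 1)) - entrySum (A m) + entrySum K := by
  rw [conj_recursion hA hK h0 h1, entrySum_add, entrySum_sub, entrySum_smul]

lemma antisymm_of_conj {P : Matrix (Fin 2) (Fin 2) ℝ} {c : ℝ} (hP : P.det = 1)
    {A : ℕ → Matrix (Fin 2) (Fin 2) ℝ} (hA : ∀ m, A (m + 2) = P * A m * P.transpose)
    (h0 : A 0 0 1 - A 0 1 0 = c) (h1 : A 1 0 1 - A 1 1 0 = c) (m : ℕ) :
    A m 0 1 - A m 1 0 = c := by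
  induction m using Nat.twoStepInduction with
  | zero => exact h0
  | one => exact h1
  | more m ih _ => rw [hA, antisymm_conj hP, ih]

lemma det_horizontalMatrix (k : ℕ) : (horizontalMatrix k).det = 1 := by
  rw [horizontalMatrix, Matrix.det_fin_two_of]; ring

lemma det_diagonalMatrix (k : ℕ) : (diagonalMatrix k).det = 1 := by
  rw [diagonalMatrix, Matrix.det_fin_two_of]; ring

/-- The only crossing is at a midpoint; the tie counts as not closer to the right, so the chain
ascends. This is the source of the asymmetry `-k`. -/
lemma fenceMatrix_one_one (k : ℕ) : fenceMatrix k (0 + 1) 1 = !![1, 0; (k : ℝ), 1] := by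
  rw [fenceMatrix_horizontal, seqProd_zero, one_mul, decide_eq_false (by omega),
    chainMatrix_false]

lemma fenceMatrix_two_one (k : ℕ) : fenceMatrix k (1 + 1) 1 =
    !![2 * (k : ℝ) ^ 2 + 3 * k + 2, (k : ℝ) + 1; 2 * (k : ℝ) + 1, 1] := by
  rw [fenceMatrix_horizontal, seqProd_succ, seqProd_zero, one_mul, horizontalCell,
    decide_eq_true (by omega), decide_eq_false (by omega), decide_eq_false (by omega)]
  simp only [stepMatrix_true, stepMatrix_false, chainMatrix_true, chainMatrix_false,
    Matrix.mul_fin_two]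
  ext i j
  fin_cases i <;> fin_cases j <;> simp <;> ring

lemma fenceMatrix_three_two (k : ℕ) : fenceMatrix k (1 + 1 + 1) (1 + 1) =
    diagonalMatrix k * !![2 * (k : ℝ) ^ 2 + 3 * k + 2, 2 * (k : ℝ) + 1; (k : ℝ) + 1, 1] := by
  rw [fenceMatrix_diagonal, seqProd_succ, seqProd_zero, one_mul, diagonalCell,
    decide_eq_false (by omega), decide_eq_false (by omega), decide_eq_true (by omega)]
  simp only [stepMatrix_true, stepMatrix_false, chainMatrix_true, chainMatrix_false,
    diagonalMatrix, Matrix.mul_fin_two]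
  ext i j
  fin_cases i <;> fin_cases j <;> simp <;> ring

lemma horizontal_antisymm (k n : ℕ) :
    fenceMatrix k (n + 1) 1 0 1 - fenceMatrix k (n + 1) 1 1 0 = -(k : ℝ) := by
  refine antisymm_of_conj (A := fun n => fenceMatrix k (n + 1) 1) (det_horizontalMatrix k)
    (fenceMatrix_horizontal_add_two k) ?_ ?_ n
  · simp only [fenceMatrix_one_one]; simp
  · simp only [fenceMatrix_two_one]; simp; ring

lemma diagonal_antisymm (k n : ℕ) :
    fenceMatrix k (n + 1 + 1) (n + 1) 0 1 - fenceMatrix k (n + 1 + 1) (n + 1) 1 0 = -(k : ℝ) := by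
  refine antisymm_of_conj (A := fun n => fenceMatrix k (n + 1 + 1) (n + 1))
    (det_diagonalMatrix k) (fenceMatrix_diagonal_add_two k) ?_ ?_ n
  · have := fenceMatrix_two_one k
    simp only [zero_add, this]; simp; ring
  · simp only [fenceMatrix_three_two, diagonalMatrix, Matrix.mul_fin_two]; simp; ring

lemma mul_mul_transpose_fin_two (a b c d e f g h : ℝ) :
    !![a, b; c, d] * !![e, f; g, h] * Matrix.transpose !![a, b; c, d] =
      !![(a * e + b * g) * a + (a * f + b * h) * b, (a * e + b * g) * c + (a * f + b * h) * d;
        (c * e + d * g) * a + (c * f + d * h) * b,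
        (c * e + d * g) * c + (c * f + d * h) * d] := by
  ext i j
  fin_cases i <;> fin_cases j <;> simp [Matrix.mul_apply, Fin.sum_univ_two]

lemma entrySum_horizontal (k n : ℕ) :
    entrySum (fenceMatrix k (n + 2 + 1) 1) = (2 * k + 3) * entrySum (fenceMatrix k (n + 1 + 1) 1) -
      entrySum (fenceMatrix k (n + 1) 1) - k := by
  have h0 := fenceMatrix_one_one k
  have h1 := fenceMatrix_two_one k
  have h2 := fenceMatrix_horizontal_add_two k 0
  have h3 := fenceMatrix_horizontal_add_two k 1
  rw [h0, horizontalMatrix, mul_mul_transpose_fin_two] at h2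
  rw [h1, horizontalMatrix, mul_mul_transpose_fin_two] at h3
  -- Here `t` is the trace of `horizontalMatrix k`, and `K` is the defect `A 2 - t • A 1 + A 0`,
  -- which the conjugation fixes.
  have := entrySum_conj_recursion (A := fun n => fenceMatrix k (n + 1) 1) (t := 2 * k + 3)
    (K := !![(k : ℝ) * (2 * k + 1), 0; -(k * (2 * k + 1)), -k])
    (fenceMatrix_horizontal_add_two k) ?_ ?_ ?_ n
  · rw [this]
    simp [entrySum]
    ring
  · rw [horizontalMatrix, mul_mul_transpose_fin_two]
    ext i j
    fin_cases i <;> fin_cases j <;> simp <;> ring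
  · simp only [Nat.zero_add, Nat.reduceAdd] at h0 h1 h2 ⊢
    rw [h0, h1, h2]
    ext i j
    fin_cases i <;> fin_cases j <;> simp <;> ring
  · simp only [Nat.zero_add, Nat.reduceAdd] at h1 h2 h3 ⊢
    rw [h1, h2, h3]
    ext i j
    fin_cases i <;> fin_cases j <;> simp <;> ring

lemma entrySum_diagonal (k n : ℕ) :
    entrySum (fenceMatrix k (n + 2 + 1 + 1) (n + 2 + 1)) =
      (3 * k ^ 2 + 8 * k + 6) * entrySum (fenceMatrix k (n + 1 + 1 + 1) (n + 1 + 1)) -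
        entrySum (fenceMatrix k (n + 1 + 1) (n + 1)) - k * (k + 2) := by
  have h0 := fenceMatrix_two_one k
  have h1 := fenceMatrix_three_two k
  have h2 := fenceMatrix_diagonal_add_two k 0
  have h3 := fenceMatrix_diagonal_add_two k 1
  rw [diagonalMatrix, Matrix.mul_fin_two] at h1
  simp only [Nat.zero_add, Nat.reduceAdd] at h0 h1 h2 h3
  rw [h0, diagonalMatrix, mul_mul_transpose_fin_two] at h2
  rw [h1, diagonalMatrix, mul_mul_transpose_fin_two] at h3
  -- Again `t` is the trace, now of `diagonalMatrix k`, and `K` the defect of the first three terms.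
  have := entrySum_conj_recursion (A := fun n => fenceMatrix k (n + 1 + 1) (n + 1))
    (t := 3 * k ^ 2 + 8 * k + 6)
    (K := !![-((k : ℝ) * (3 * k ^ 2 + 6 * k + 4)), k * (3 * k ^ 2 + 5 * k + 2);
      -(k * (3 * k + 2)), k * (3 * k + 2)])
    (fenceMatrix_diagonal_add_two k) ?_ ?_ ?_ n
  · rw [this]
    simp [entrySum]
    ring
  · rw [diagonalMatrix, mul_mul_transpose_fin_two]
    ext i j
    fin_cases i <;> fin_cases j <;> simp <;> ring
  · simp only [Nat.zero_add, Nat.reduceAdd]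
    rw [h0, h1, h2]
    ext i j
    fin_cases i <;> fin_cases j <;> simp <;> ring
  · simp only [Nat.reduceAdd]
    rw [h1, h2, h3]
    ext i j
    fin_cases i <;> fin_cases j <;> simp <;> ring

/-! ### Asymptotics -/

/-- The constant sequence `c` solves the inhomogeneous recursion; `l` and `l'` are the roots of the
homogeneous one. -/
lemma recursion_closed_form {x : ℕ → ℝ} {l l' a a' c : ℝ} (hl : l * l' = 1)
    (hx : ∀ n, x (n + 2) = (l + l') * x (n + 1) - x n - c * (l + l' - 2))
    (h0 : x 0 = a * l + a' * l' + c) (h1 : x 1 = a * l ^ 2 + a' * l' ^ 2 + c) (n : ℕ) :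
    x n = a * l ^ (n + 1) + a' * l' ^ (n + 1) + c := by
  induction n using Nat.twoStepInduction with
  | zero => simpa using h0
  | one => exact h1
  | more n ih1 ih2 =>
    rw [hx, ih1, ih2]
    have e1 : l' * l ^ (n + 2) = l ^ (n + 1) := by
      rw [pow_succ l (n + 1)]; linear_combination l ^ (n + 1) * hl
    have e2 : l * l' ^ (n + 2) = l' ^ (n + 1) := by
      rw [pow_succ l' (n + 1)]; linear_combination l' ^ (n + 1) * hl
    linear_combination a * e1 + a' * e2

lemma tendsto_recursion {x : ℕ → ℝ} {l l' a a' c : ℝ} (hl : l * l' = 1) (hl1 : 1 < l)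
    (hx : ∀ n, x (n + 2) = (l + l') * x (n + 1) - x n - c * (l + l' - 2))
    (h0 : x 0 = a * l + a' * l' + c) (h1 : x 1 = a * l ^ 2 + a' * l' ^ 2 + c) :
    Tendsto (fun n => x n / l ^ (n + 1)) atTop (𝓝 a) := by
  have hl0 : 0 < l := by linarith
  have hl' : l' = l⁻¹ := eq_inv_of_mul_eq_one_right hl
  have hsmall : Tendsto (fun n : ℕ => l' ^ (n + 1)) atTop (𝓝 0) :=
    (tendsto_add_atTop_iff_nat 1).2 (tendsto_pow_atTop_nhds_zero_of_lt_one
      (by rw [hl']; positivity) (by rw [hl']; exact inv_lt_one_of_one_lt₀ hl1))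
  have key : ∀ n, x n / l ^ (n + 1) = a + a' * (l' ^ (n + 1) * l' ^ (n + 1)) + c * l' ^ (n + 1) := by
    intro n
    rw [recursion_closed_form hl hx h0 h1, div_eq_mul_inv, ← inv_pow, ← hl']
    have : l ^ (n + 1) * l' ^ (n + 1) = 1 := by rw [← mul_pow, hl, one_pow]
    linear_combination a * this
  simp only [key]
  simpa using ((tendsto_const_nhds (x := a)).add ((hsmall.mul hsmall).const_mul a')).add
    (hsmall.const_mul c)

/-- After division by the appropriate power of `m`, the multiplier tends to `3 + 3k` and the term
two steps back carries a factor `m⁻²`, which vanishes in the limit. -/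
lemma tendsto_chebValue {ι : Type*} {f : Filter ι} (k : ℕ) {m : ι → ℝ} (hm : Tendsto m f atTop)
    (d : ℕ) : Tendsto (fun i => chebValue k (m i) d / m i ^ (d + 1)) f (𝓝 ((3 + 3 * k) ^ d)) := by
  have hinv : Tendsto (fun i => (m i)⁻¹) f (𝓝 0) := tendsto_inv_atTop_zero.comp hm
  have hpos : ∀ᶠ i in f, m i ≠ 0 := hm.eventually_ne_atTop 0
  have htr : Tendsto (fun i => (3 + 3 * k : ℝ) - k * (m i)⁻¹) f (𝓝 (3 + 3 * k)) := by
    simpa using (tendsto_const_nhds (x := (3 + 3 * k : ℝ))).sub (hinv.const_mul (k : ℝ))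
  induction d using Nat.twoStepInduction with
  | zero =>
    rw [pow_zero]
    refine tendsto_const_nhds.congr' ?_
    filter_upwards [hpos] with i hi
    simp [chebValue, hi]
  | one =>
    rw [pow_one]
    refine htr.congr' ?_
    filter_upwards [hpos] with i hi
    rw [chebValue]
    field_simp
    ring
  | more d ih1 ih2 =>
    have := (htr.mul ih2).sub ((hinv.mul hinv).mul ih1)
    rw [zero_mul, zero_mul, sub_zero, ← pow_succ'] at this
    refine this.congr' ?_
    filter_upwards [hpos] with i hi
    rw [chebValue]
    field_simp
    ring

/-- The limit of a quotient of a term of a sequence asymptotic to a geometric one and a value at a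
multiple. -/
lemma tendsto_div_chebValue (k : ℕ) {x : ℕ → ℝ} {l a : ℝ} (hl : 1 < l) (ha : 0 < a)
    (hx : Tendsto (fun n => x n / l ^ n) atTop (𝓝 a)) (d e : ℕ) :
    Tendsto (fun q => x (q * (d + 1) + e) / chebValue k (x q) d) atTop
      (𝓝 (((3 + 3 * k) * a) ^ (-(d : ℤ)) * l ^ e)) := by
  have hl0 : 0 < l := by linarith
  have hx_top : Tendsto x atTop atTop := by
    have := hx.pos_mul_atTop ha (tendsto_pow_atTop_atTop_of_one_lt hl)
    refine this.congr fun n => ?_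
    field_simp
  have hsub : Tendsto (fun q : ℕ => q * (d + 1) + e) atTop atTop :=
    tendsto_atTop_mono (fun q => by simp only [id]; nlinarith [Nat.zero_le (q * d)]) tendsto_id
  have h1 := hx.comp hsub
  have h2 := (tendsto_chebValue k hx_top d).mul (hx.pow (d + 1))
  have h3 := (h1.div h2 (by positivity)).mul_const (l ^ e)
  have hlim : a / ((3 + 3 * (k : ℝ)) ^ d * a ^ (d + 1)) * l ^ e =
      ((3 + 3 * k) * a) ^ (-(d : ℤ)) * l ^ e := by
    rw [zpow_neg, zpow_natCast, mul_pow]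
    field_simp
    ring
  rw [hlim] at h3
  refine h3.congr' ?_
  filter_upwards [hx_top.eventually_ne_atTop 0] with q hq
  simp only [Function.comp, Pi.div_apply]
  have e1 : l ^ (q * (d + 1) + e) = (l ^ q) ^ (d + 1) * l ^ e := by rw [pow_add, pow_mul]
  rw [e1, div_pow]
  have : l ^ q ≠ 0 := by positivity
  -- If the denominator vanishes, both sides are 0 by the convention for division, so its
  -- nonvanishing need not be proved.
  by_cases hc : chebValue k (x q) d = 0
  · simp [hc]
  · field_simp

/-! ### Growth of the two families. -/

lemma genMarkov_horizontal (k n : ℕ) :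
    (genMarkov k (n + 1 : ℕ) 1 : ℝ) = entrySum (fenceMatrix k (n + 1) 1) := by
  exact_mod_cast genMarkov_eq n.succ_pos one_pos k

lemma genMarkov_diagonal (k n : ℕ) :
    (genMarkov k (n + 1 + 1 : ℕ) (n + 1 : ℕ) : ℝ) =
      entrySum (fenceMatrix k (n + 1 + 1) (n + 1)) :=
  genMarkov_eq (by positivity) (by positivity) k

lemma tendsto_genMarkov_horizontal (k : ℕ) {α A : ℝ} (hα : α = 4 * (k : ℝ) ^ 2 + 12 * k + 5)
    (hA : A = (2 * (k : ℝ) ^ 2 + 3 * k + 1 + (1 + k) * √α) / (2 * (1 + 2 * k) * √α)) :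
    Tendsto (fun n : ℕ => (genMarkov k n 1 : ℝ) / ((3 + 2 * k + √α) / 2) ^ n) atTop (𝓝 A) := by
  have hα0 : 0 < α := by rw [hα]; positivity
  have hs : 0 < √α := Real.sqrt_pos.2 hα0
  have hsq : √α ^ 2 = 4 * (k : ℝ) ^ 2 + 12 * k + 5 := by rw [Real.sq_sqrt hα0.le, hα]
  set s := √α
  have hk : (0 : ℝ) < 1 + 2 * k := by positivity
  -- Since `2k² + 3k + 1 = (1 + k)(1 + 2k)`, the coefficient splits into a rational part and a
  -- multiple of `1 / s`; `a'` below is its conjugate under `s ↦ -s`.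
  have hA' : A = (1 + k) / (2 * (1 + 2 * k)) + (1 + k) / (2 * s) := by
    rw [hA]; field_simp; ring
  rw [← tendsto_add_atTop_iff_nat 1]
  simp only [genMarkov_horizontal]
  refine tendsto_recursion (l' := (3 + 2 * k - s) / 2)
    (a' := (1 + k) / (2 * (1 + 2 * k)) - (1 + k) / (2 * s)) (c := k / (1 + 2 * k))
    (x := fun n => entrySum (fenceMatrix k (n + 1) 1)) ?_ ?_ ?_ ?_ ?_
  · linear_combination - hsq / 4
  · have : (0 : ℝ) ≤ k := by positivity
    linarith
  · intro n
    rw [entrySum_horizontal]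
    field_simp
    ring
  · rw [fenceMatrix_one_one, hA']
    simp [entrySum]
    field_simp
    ring
  · rw [fenceMatrix_two_one, hA']
    simp [entrySum]
    field_simp
    linear_combination (-2 : ℝ) * (1 + k) * s * hsq

lemma tendsto_genMarkov_diagonal (k : ℕ) {β δ B : ℝ} (hβ : β = 3 * (k : ℝ) ^ 2 + 8 * k + 6)
    (hδ : δ = 3 * (k : ℝ) ^ 4 + 17 * (k : ℝ) ^ 3 + 34 * (k : ℝ) ^ 2 + 28 * k + 8)
    (hB : B = ((k + 1) * (k + 2) * (β ^ 2 - 4) + δ * √(β ^ 2 - 4)) /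
      ((β - 2) * (β ^ 2 - 4))) :
    Tendsto (fun n : ℕ => (genMarkov k (n + 1 : ℕ) n : ℝ) / ((β + √(β ^ 2 - 4)) / 2) ^ n) atTop
      (𝓝 B) := by
  have hk0 : (0 : ℝ) ≤ k := by positivity
  have hβ2 : 0 < β - 2 := by rw [hβ]; nlinarith
  have hβ4 : 0 < β ^ 2 - 4 := by nlinarith
  have hs : 0 < √(β ^ 2 - 4) := Real.sqrt_pos.2 hβ4
  have hsq : √(β ^ 2 - 4) ^ 2 = β ^ 2 - 4 := Real.sq_sqrt hβ4.le
  set s := √(β ^ 2 - 4)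
  -- Writing `β ^ 2 - 4` as `s ^ 2` lets one factor `s` cancel.
  rw [← hsq] at hB
  have hB' : B = (k + 1) * (k + 2) / (β - 2) + δ / ((β - 2) * s) := by
    rw [hB]; field_simp
  rw [← tendsto_add_atTop_iff_nat 1]
  simp only [genMarkov_diagonal]
  refine tendsto_recursion (l' := (β - s) / 2)
    (a' := (k + 1) * (k + 2) / (β - 2) - δ / ((β - 2) * s)) (c := k * (k + 2) / (β - 2))
    (x := fun n => entrySum (fenceMatrix k (n + 1 + 1) (n + 1))) ?_ ?_ ?_ ?_ ?_
  · linear_combination - hsq / 4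
  · linarith
  · intro n
    rw [entrySum_diagonal, ← hβ]
    field_simp
    ring
  · have := fenceMatrix_two_one k
    simp only [zero_add, this, hB']
    simp [entrySum]
    field_simp
    rw [hδ, hβ]
    ring
  · simp only [fenceMatrix_three_two, hB', diagonalMatrix, Matrix.mul_fin_two]
    simp [entrySum]
    field_simp
    clear_value s
    subst hδ hβ
    linear_combination -(2 * (k : ℝ) ^ 2 + 6 * k + 4) * s * hsq

theorem mainTheorem5 (k : ℕ) (α β δ A B : ℝ)
    (hα : α = 4 * (k : ℝ) ^ 2 + 12 * k + 5)
    (hβ : β = 3 * (k : ℝ) ^ 2 + 8 * k + 6)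
    (hδ : δ = 3 * (k : ℝ) ^ 4 + 17 * (k : ℝ) ^ 3 + 34 * (k : ℝ) ^ 2 + 28 * k + 8)
    (hA : A = (2 * (k : ℝ) ^ 2 + 3 * k + 1 + (1 + k) * √α) / (2 * (1 + 2 * k) * √α))
    (hB : B = ((k + 1) * (k + 2) * (β ^ 2 - 4) + δ * √(β ^ 2 - 4)) /
      ((β - 2) * (β ^ 2 - 4)))
    (a₁ a₂ : ℕ) (ha₁ : 0 < a₁) (ha₂ : 0 < a₂) (hcop : Nat.Coprime a₁ a₂) :
    Tendsto (fun q : ℕ =>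
        (genMarkov k (q * (1 + a₁) + a₂) 1 : ℝ) /
          (genMarkov k (q * (1 + a₁)) (1 + a₁) : ℝ))
      atTop
      (𝓝 (((3 + 3 * k) * A) ^ (-(a₁ : ℤ)) * ((3 + 2 * k + √α) / 2) ^ a₂)) ∧
    Tendsto (fun q : ℕ =>
        (genMarkov k ((q + 1) * (1 + a₁ + a₂)) (q * (1 + a₁ + a₂)) : ℝ) /
          (genMarkov k (q * (1 + a₁ + a₂) + a₁ + 1) (q * (1 + a₁ + a₂) + a₁) : ℝ))
      atTop
      (𝓝 (((3 + 3 * k) * B) ^ (a₁ + a₂) * ((β + √(β ^ 2 - 4)) / 2) ^ (-(a₁ : ℤ)))) := by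
  have hk0 : (0 : ℝ) ≤ k := by positivity
  constructor
  · have hα0 : 0 < α := by rw [hα]; positivity
    have hA0 : 0 < A := by
      have := Real.sqrt_pos.2 hα0
      rw [hA]; positivity
    have hl : 1 < (3 + 2 * k + √α) / 2 := by
      have := Real.sqrt_pos.2 hα0
      linarith
    refine (tendsto_div_chebValue k hl hA0 (tendsto_genMarkov_horizontal k hα hA) a₁ a₂).congr' ?_
    filter_upwards [eventually_ge_atTop 1] with q hq
    -- The denominator belongs to the multiple by `a₁ + 1` of `(q, 1)`.
    obtain ⟨n, rfl⟩ : ∃ n, q = n + 1 := ⟨q - 1, by omega⟩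
    have := genMarkov_multiple k n.succ_pos one_pos (horizontal_antisymm k n) a₁
    push_cast at this ⊢
    rw [← this]
    congr 3 <;> ring_nf
  · have hβ2 : 0 < β - 2 := by rw [hβ]; nlinarith
    have hβ4 : 0 < β ^ 2 - 4 := by nlinarith
    have hδ0 : 0 < δ := by rw [hδ]; positivity
    have hs := Real.sqrt_pos.2 hβ4
    have hB0 : 0 < B := by rw [hB]; positivity
    have hl : 1 < (β + √(β ^ 2 - 4)) / 2 := by linarith
    -- Now the multiple, by `a₁ + a₂ + 1` of `(q + 1, q)`, is in the numerator, so the inverse of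
    -- the general limit applies.
    have h1 := (tendsto_div_chebValue k hl hB0 (tendsto_genMarkov_diagonal k hβ hδ hB)
      (a₁ + a₂) a₁).inv₀ (by positivity)
    rw [mul_inv, zpow_neg, inv_inv, zpow_natCast, ← zpow_natCast _ a₁, ← zpow_neg] at h1
    refine h1.congr' ?_
    filter_upwards [eventually_ge_atTop 1] with q hq
    obtain ⟨n, rfl⟩ : ∃ n, q = n + 1 := ⟨q - 1, by omega⟩
    have := genMarkov_multiple k (n + 1).succ_pos n.succ_pos (diagonal_antisymm k n) (a₁ + a₂)
    push_cast at this ⊢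
    rw [← this, inv_div]
    congr 3 <;> ring_nf
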